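/- Let $\Lambda$ be an artin algebra, let $\Lambda$-Mod (resp. $\Lambda$-mod) be the category of all (resp. all finitely generated) left $\Lambda$-modules, and let $n\ge 2$. Conventions. All subcategories are full. For a subcategory $\mathcal M$ of an abelian category $\mathcal A$ put $${}^{\perp_n}\mathcal M=\{X\in\mathcal A : \mathrm{Ext}^i_{\mathcal A}(X,\mathcal M)=0 \text{ for all } 0<i<n\},\qquad \mathcal M^{\perp_n}=\{Y\in\mathcal A : \mathrm{Ext}^i_{\mathcal A}(\mathcal M,Y)=0\text{ for all } 0<i<n\}.$$ $\mathcal M$ is *$n$-cluster tilting* in $\mathcal A$ if every object of $\mathcal A$ is a quotient of an object of $\mathcal M$ and a subobject of an object of $\mathcal M$, $\mathcal M$ is functorially finite in $\mathcal A$ (every $A\in\mathcal A$ has a morphism $M\to A$ with $M\in\mathcal M$ through which every morphism from an object of $\mathcal M$ to $A$ factors, and a morphism $A\to M'$ with $M'\in\mathcal M$ through which every morphism from $A$ to an object of $\mathcal M$ factors), and $\mathcal M^{\perp_n}=\mathcal M={}^{\perp_n}\mathcal M$. It is *$n$-rigid* if $\mathrm{Ext}^k_{\mathcal A}(\mathcal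 M,\mathcal M)=0$ for all $1\le k\le n-1$. It is *of finite type* if it has an additive generator, i.e. there is an object $G$ such that the objects of $\mathcal M$ are exactly the direct summands of finite direct sums of copies of $G$. For a subcategory $\mathcal M$ of $\Lambda$-mod, $\mathrm{Add}(\mathcal M)$ is the subcategory of $\Lambda$-Mod of all direct summands of arbitrary direct sums of modules in $\mathcal M$, and $\varinjlim\mathcal M$ is the subcategory of $\Lambda$-Mod of all filtered colimits (direct limits) of modules in $\mathcal M$. A submodule $N\subseteq X$ is *pure* if every homomorphism from a finitely presented module to $X/N$ lifts to $X$. A sequence $0\to A\to B\to C\to 0$ in $\varinjlim\mathcal M$ is *pure-exact* if $0\to\mathrm{Hom}_\Lambda(M,A)\to\mathrm{Hom}_\Lambda(M,B)\to\mathrm{Hom}_\Lambda(M,C)\to 0$ is exact for every $M\in\mathcal M$, and $\varinjlim\mathcal M$ is *pure semisimple* if every pure-exact sequence in it splits. Theorem. Let $\mathcal M$ be an $n$-cluster tilting subcategory of $\Lambda$-mod. Then the following statements are equivalent. (a) $\mathcal M$ is of finite type. (b) $\varinjlim\mathcal M$ is an $n$-cluster tilting subcategory of $\Lambda$-Mod.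 (c) $\varinjlim\mathcal M$ is an $n$-rigid subcategory of $\Lambda$-Mod. (d) $\mathrm{Ext}^1_\Lambda(\varinjlim\mathcal M,\varinjlim\mathcal M)=0$. (e) Every pure submodule $N$ of a module $X$ in $\mathrm{Add}(\mathcal M)$ is a direct summand of $X$. (f) $\varinjlim\mathcal M$ is pure semisimple. -/

import Mathlib

open CategoryTheory Limits

universe u v

/-- `Λ` is an artin algebra: a ring which is a finitely generated module over some commutative
artinian ring `R` acting centrally.  (Over a larger universe of rings `R` nothing changes, since
`R` may be replaced by its image in `Λ`.) -/
class IsArtinAlgebra (Λ : Type u) [Ring Λ] : Prop where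
  exists_finite : ∃ (R : Type u) (_ : CommRing R) (_ : IsArtinianRing R) (_ : Algebra R Λ),
    Module.Finite R Λ

/-- An artin algebra is left noetherian; hence `FGModuleCat Λ`, the category `Λ`-mod of finitely
generated left `Λ`-modules, is abelian. -/
instance IsArtinAlgebra.isNoetherianRing (Λ : Type u) [Ring Λ] [h : IsArtinAlgebra Λ] :
    IsNoetherianRing Λ := by
  obtain ⟨R, _, _, _, _⟩ := h.exists_finite
  exact IsNoetherianRing.of_finite R Λ

namespace ClusterTilting

/-! ### Full subcategories of an abelian category

A full subcategory is given by the property `P` of belonging to it. -/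

section Abelian

variable {C : Type u} [Category.{v} C]

/-- Every object is a quotient of an object of `P`. -/
def IsGenerating (P : ObjectProperty C) : Prop :=
  ∀ A : C, ∃ (M : C) (f : M ⟶ A), P M ∧ Epi f

/-- Every object is a subobject of an object of `P`. -/
def IsCogenerating (P : ObjectProperty C) : Prop :=
  ∀ A : C, ∃ (M : C) (f : A ⟶ M), P M ∧ Mono f

/-- `θ : M ⟶ A` is a right `P`-approximation of `A`. -/
def IsRightApproximation (P : ObjectProperty C) {M A : C} (θ : M ⟶ A) : Prop :=
  P M ∧ ∀ (M' : C) (f : M' ⟶ A), P M' → ∃ g : M' ⟶ M, g ≫ θ = f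

/-- `θ : A ⟶ M` is a left `P`-approximation of `A`. -/
def IsLeftApproximation (P : ObjectProperty C) {A M : C} (θ : A ⟶ M) : Prop :=
  P M ∧ ∀ (M' : C) (f : A ⟶ M'), P M' → ∃ g : M ⟶ M', θ ≫ g = f

def IsContravariantlyFinite (P : ObjectProperty C) : Prop :=
  ∀ A : C, ∃ (M : C) (θ : M ⟶ A), IsRightApproximation P θ

def IsCovariantlyFinite (P : ObjectProperty C) : Prop :=
  ∀ A : C, ∃ (M : C) (θ : A ⟶ M), IsLeftApproximation P θ

def IsFunctoriallyFinite (P : ObjectProperty C) : Prop :=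
  IsContravariantlyFinite P ∧ IsCovariantlyFinite P

variable [Abelian C]

/-- `Ext^i(X, Y) = 0` in the abelian category `C`. -/
def ExtVanishes (X Y : C) (i : ℕ) : Prop :=
  letI : HasExt.{max u v} C := HasExt.standard C
  ∀ e : Abelian.Ext.{max u v} X Y i, e = 0

/-- The objects `X` with `Ext^i(X, P) = 0` for all `0 < i < n`. -/
def leftPerp (n : ℕ) (P : ObjectProperty C) : ObjectProperty C :=
  fun X ↦ ∀ i : ℕ, 0 < i → i < n → ∀ Y : C, P Y → ExtVanishes X Y i

/-- The objects `Y` with `Ext^i(P, Y) = 0` for all `0 < i < n`. -/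
def rightPerp (n : ℕ) (P : ObjectProperty C) : ObjectProperty C :=
  fun Y ↦ ∀ i : ℕ, 0 < i → i < n → ∀ X : C, P X → ExtVanishes X Y i

/-- `n`-cluster tilting subcategories of an abelian category. -/
structure IsNClusterTilting (n : ℕ) (P : ObjectProperty C) : Prop where
  generating : IsGenerating P
  cogenerating : IsCogenerating P
  functoriallyFinite : IsFunctoriallyFinite P
  rightPerp_eq : rightPerp n P = P
  leftPerp_eq : leftPerp n P = P

/-- `n`-rigid subcategories: `Ext^k(P, P) = 0` for all `1 ≤ k ≤ n - 1`. -/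
def IsNRigid (n : ℕ) (P : ObjectProperty C) : Prop :=
  ∀ k : ℕ, 0 < k → k < n → ∀ X Y : C, P X → P Y → ExtVanishes X Y k

/-- `P` has an additive generator: an object `G` such that the objects of `P` are exactly the
direct summands of the finite direct sums of copies of `G`. -/
def IsOfFiniteType (P : ObjectProperty C) : Prop :=
  haveI : HasFiniteBiproducts C := Abelian.hasFiniteBiproducts
  ∃ G : C, ∀ X : C, P X ↔ ∃ k : ℕ, Nonempty (Retract X (⨁ fun _ : Fin k ↦ G))

end Abelian

/-! ### Subcategories of `Λ`-Mod attached to a subcategory of `Λ`-mod -/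

section Module

variable {Λ : Type u} [Ring Λ]

/-- A full subcategory of `Λ`-mod, regarded as a full subcategory of `Λ`-Mod (closed under
isomorphisms). -/
def inMod (M : ObjectProperty (FGModuleCat.{u} Λ)) : ObjectProperty (ModuleCat.{u} Λ) :=
  M.map (ModuleCat.isFG.{u} Λ).ι

/-- `Add(M)`: the direct summands of arbitrary direct sums of modules in `M`. -/
def Add (M : ObjectProperty (FGModuleCat.{u} Λ)) : ObjectProperty (ModuleCat.{u} Λ) :=
  fun X ↦ ∃ (ι : Type u) (F : ι → FGModuleCat.{u} Λ), (∀ i, M (F i)) ∧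
    Nonempty (Retract X (ModuleCat.of Λ (DirectSum ι fun i ↦ (F i).obj)))

/-- `lim M`: the filtered colimits, in `Λ`-Mod, of modules in `M`. -/
def lim (M : ObjectProperty (FGModuleCat.{u} Λ)) : ObjectProperty (ModuleCat.{u} Λ) :=
  ObjectProperty.ind.{u} (inMod M)

/-- `N` is a pure submodule of `X`: every homomorphism from a finitely presented module to `X ⧸ N`
lifts to `X`. -/
def IsPureSubmodule {X : Type u} [AddCommGroup X] [Module Λ X] (N : Submodule Λ X) : Prop :=
  ∀ (F : Type u) [AddCommGroup F] [Module Λ F] [Module.FinitePresentation Λ F]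
    (f : F →ₗ[Λ] X ⧸ N), ∃ g : F →ₗ[Λ] X, N.mkQ ∘ₗ g = f

/-- `A ⟶ B ⟶ C` (with zero composite) is pure-exact with respect to `M`: for every `U` in `M` the
sequence `0 ⟶ Hom(U, A) ⟶ Hom(U, B) ⟶ Hom(U, C) ⟶ 0` is exact. -/
def IsPureExact (M : ObjectProperty (FGModuleCat.{u} Λ)) (S : ShortComplex (ModuleCat.{u} Λ)) :
    Prop :=
  ∀ U : FGModuleCat.{u} Λ, M U →
    Function.Injective (fun a : U.obj ⟶ S.X₁ ↦ a ≫ S.f) ∧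
    (∀ b : U.obj ⟶ S.X₂, b ≫ S.g = 0 → ∃ a : U.obj ⟶ S.X₁, a ≫ S.f = b) ∧
    Function.Surjective (fun b : U.obj ⟶ S.X₂ ↦ b ≫ S.g)

/-- `lim M` is pure semisimple: every pure-exact sequence in `lim M` splits. -/
def LimIsPureSemisimple (M : ObjectProperty (FGModuleCat.{u} Λ)) : Prop :=
  ∀ S : ShortComplex (ModuleCat.{u} Λ), lim M S.X₁ → lim M S.X₂ → lim M S.X₃ →
    IsPureExact M S → Nonempty S.Splitting

end Module

end ClusterTilting

namespace ClusterTilting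

/-! ### Vanishing of Ext groups -/

section ExtVanishes

open Abelian

variable {C : Type u} [Category.{v} C] [Abelian C]

/-! The pivot is the inclusion `lim M ≤ Add M`. Once it is known, rigidity is immediate: for `C` in
`lim M` and `0 < i < n`, Ext^i(-, C) vanishes on `M`, and vanishing passes to direct sums and
summands (`extVanishes_add`).

A module lies in `lim M` iff morphisms to it from finitely generated modules factor through `M`,
equivalently extend along left approximations (`lim_iff_exists_factorization`, `lim_iff_extension`);
hence `lim M` is closed under products and pure submodules. Dimension shifting along approximations
puts the right perpendicular of `M` in Λ-Mod inside `lim M`, and the left perpendicular of `lim M`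
inside `Add M` (`lim_of_extVanishes`, `add_of_extVanishes`). With the splitting of pure submodules
this upgrades rigidity to cluster tilting.

If Ext^1 vanishes on `lim M`, pure-exact sequences split; a pure submodule of a module in `Add M`
gives such a sequence, so it is a summand. Right approximations of objects of `lim M` have pure
kernels, so (e) yields `lim M ≤ Add M`.

Finite type enters through T-nilpotence: a sequence of morphisms without retractions between
indecomposables of `M` eventually kills each element. Under finite type this is nilpotency of the
radical of an endomorphism ring (`isTNilpotent_of_retract`). Under (e) it follows by splitting the
telescope of the sequence, whose image is pure (`isPureSubmodule_range_telescope`). T-nilpotence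
produces in every nonzero object of `lim M` a nonzero pure submodule from `M`, and a maximal
independent family of such submodules with pure sum exhausts the object (`IsTNilpotent.lim_le_add`).

Finally, T-nilpotence and `lim M ≤ Add M` give finite type (`IsTNilpotent.exists_equiv`). Infinitely
many nonisomorphic indecomposables `X i` would produce an endless chain: a morphism from an
indecomposable `Y` to a product of `X i` factors through an object of `M`, because the product lies
in `Add M`. The chain consists of nonsplit morphisms by `exists_retraction_of_pi`, which rests on
duality over the artinian base ring. -/

lemma ExtVanishes.of_sum_eq_id {X Y : C} {i : ℕ} {ι : Type*} [Fintype ι] (Z : ι → C)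
    (p : ∀ j, X ⟶ Z j) (q : ∀ j, Z j ⟶ X) (h : ∑ j, p j ≫ q j = 𝟙 X)
    (hZ : ∀ j, ExtVanishes (Z j) Y i) : ExtVanishes X Y i := by
  let : HasExt.{max u v} C := HasExt.standard C
  intro e
  rw [← Ext.mk₀_id_comp e, ← h, Ext.mk₀_sum, Ext.sum_comp]
  refine Finset.sum_eq_zero fun j _ ↦ ?_
  have h0 : (Ext.mk₀ (q j)).comp e (zero_add i) = 0 := hZ j _
  rw [← Ext.mk₀_comp_mk₀_assoc, h0, Ext.comp_zero]

lemma ExtVanishes.of_retract {X Y Z : C} {i : ℕ} (r : Retract X Z) (h : ExtVanishes Z Y i) :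
    ExtVanishes X Y i :=
  .of_sum_eq_id (ι := Unit) (fun _ ↦ Z) (fun _ ↦ r.i) (fun _ ↦ r.r) (by simp) fun _ ↦ h

lemma extVanishes_of_projective (P Y : C) [Projective P] (i : ℕ) (hi : 0 < i) :
    ExtVanishes P Y i := by
  let : HasExt.{max u v} C := HasExt.standard C
  obtain ⟨i, rfl⟩ := Nat.exists_eq_succ_of_ne_zero hi.ne'
  exact fun e ↦ Ext.eq_zero_of_projective e

lemma extVanishes_of_injective (X I : C) [Injective I] (i : ℕ) (hi : 0 < i) :
    ExtVanishes X I i := by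
  let : HasExt.{max u v} C := HasExt.standard C
  obtain ⟨i, rfl⟩ := Nat.exists_eq_succ_of_ne_zero hi.ne'
  exact fun e ↦ Ext.eq_zero_of_injective e

variable {S : ShortComplex C} (hS : S.ShortExact)

include hS

lemma ExtVanishes.of_shortExact_left {Y : C} {i : ℕ} (h₂ : ExtVanishes S.X₂ Y i)
    (h₃ : ExtVanishes S.X₃ Y (i + 1)) : ExtVanishes S.X₁ Y i := by
  let : HasExt.{max u v} C := HasExt.standard C
  intro e
  obtain ⟨x, hx⟩ := Ext.contravariant_sequence_exact₁ hS Y e (by lia : 1 + i = i + 1) (h₃ _)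
  rw [← hx, h₂ x, Ext.comp_zero]

lemma ExtVanishes.of_shortExact_left_last {Y : C} {i : ℕ} (h₁ : ExtVanishes S.X₁ Y i)
    (h₂ : ExtVanishes S.X₂ Y (i + 1)) : ExtVanishes S.X₃ Y (i + 1) := by
  let : HasExt.{max u v} C := HasExt.standard C
  intro e
  obtain ⟨x, hx⟩ := Ext.contravariant_sequence_exact₃ hS Y e (h₂ _) (by lia : 1 + i = i + 1)
  rw [← hx, h₁ x, Ext.comp_zero]

lemma ExtVanishes.of_shortExact_right {X : C} {i : ℕ} (h₂ : ExtVanishes X S.X₂ i)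
    (h₁ : ExtVanishes X S.X₁ (i + 1)) : ExtVanishes X S.X₃ i := by
  let : HasExt.{max u v} C := HasExt.standard C
  intro e
  obtain ⟨x, hx⟩ := Ext.covariant_sequence_exact₃ X hS e rfl (h₁ _)
  rw [← hx, h₂ x, Ext.zero_comp]

lemma ExtVanishes.of_shortExact_right_first {X : C} {i : ℕ} (h₃ : ExtVanishes X S.X₃ i)
    (h₂ : ExtVanishes X S.X₂ (i + 1)) : ExtVanishes X S.X₁ (i + 1) := by
  let : HasExt.{max u v} C := HasExt.standard C
  intro e
  obtain ⟨x, hx⟩ := Ext.covariant_sequence_exact₁ X hS e (h₂ _) rfl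
  rw [← hx, h₃ x, Ext.zero_comp]

lemma ExtVanishes.exists_extension {Y : C} (h : ExtVanishes S.X₃ Y 1) (f : S.X₁ ⟶ Y) :
    ∃ g : S.X₂ ⟶ Y, S.f ≫ g = f := by
  let : HasExt.{max u v} C := HasExt.standard C
  obtain ⟨x, hx⟩ := Ext.contravariant_sequence_exact₁ hS Y (Ext.mk₀ f) rfl (h _)
  obtain ⟨g, rfl⟩ := (Ext.mk₀_bijective _ _).2 x
  rw [Ext.mk₀_comp_mk₀] at hx
  exact ⟨g, (Ext.mk₀_bijective _ _).1 hx⟩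

lemma ExtVanishes.exists_lift {X : C} (h : ExtVanishes X S.X₁ 1) (f : X ⟶ S.X₃) :
    ∃ g : X ⟶ S.X₂, g ≫ S.g = f := by
  let : HasExt.{max u v} C := HasExt.standard C
  obtain ⟨x, hx⟩ := Ext.covariant_sequence_exact₃ X hS (Ext.mk₀ f) rfl (h _)
  obtain ⟨g, rfl⟩ := (Ext.mk₀_bijective _ _).2 x
  rw [Ext.mk₀_comp_mk₀] at hx
  exact ⟨g, (Ext.mk₀_bijective _ _).1 hx⟩

lemma extVanishes_one_of_extension {Y : C} (h₂ : ExtVanishes S.X₂ Y 1)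
    (h : ∀ f : S.X₁ ⟶ Y, ∃ g : S.X₂ ⟶ Y, S.f ≫ g = f) : ExtVanishes S.X₃ Y 1 := by
  let : HasExt.{max u v} C := HasExt.standard C
  intro e
  obtain ⟨x, hx⟩ := Ext.contravariant_sequence_exact₃ hS Y e (h₂ _) (rfl : 1 + 0 = 1)
  obtain ⟨f, rfl⟩ := (Ext.mk₀_bijective _ _).2 x
  obtain ⟨g, rfl⟩ := h f
  rw [← hx, ← Ext.mk₀_comp_mk₀, ← Ext.comp_assoc (h := by lia), hS.extClass_comp, Ext.zero_comp]
  all_goals lia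

lemma extVanishes_one_of_lift {X : C} (h₂ : ExtVanishes X S.X₂ 1)
    (h : ∀ f : X ⟶ S.X₃, ∃ g : X ⟶ S.X₂, g ≫ S.g = f) : ExtVanishes X S.X₁ 1 := by
  let : HasExt.{max u v} C := HasExt.standard C
  intro e
  obtain ⟨x, hx⟩ := Ext.covariant_sequence_exact₁ X hS e (h₂ _) rfl
  obtain ⟨f, rfl⟩ := (Ext.mk₀_bijective _ _).2 x
  obtain ⟨g, rfl⟩ := h f
  rw [← hx, ← Ext.mk₀_comp_mk₀, Ext.comp_assoc (h := by lia), hS.comp_extClass, Ext.comp_zero]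
  all_goals lia

lemma extVanishes_one_iff_of_projective {Y : C} [Projective S.X₂] :
    ExtVanishes S.X₃ Y 1 ↔ ∀ f : S.X₁ ⟶ Y, ∃ g : S.X₂ ⟶ Y, S.f ≫ g = f :=
  ⟨fun h ↦ h.exists_extension hS,
    extVanishes_one_of_extension hS (extVanishes_of_projective _ _ _ one_pos)⟩

lemma extVanishes_add_two_iff_of_projective {Y : C} [Projective S.X₂] {i : ℕ} :
    ExtVanishes S.X₃ Y (i + 2) ↔ ExtVanishes S.X₁ Y (i + 1) :=
  ⟨fun h ↦ .of_shortExact_left hS (extVanishes_of_projective _ _ _ (by lia)) h,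
    fun h ↦ .of_shortExact_left_last hS h (extVanishes_of_projective _ _ _ (by lia))⟩

end ExtVanishes

/-! ### Finitely presentable objects of the category of modules -/

section FinitelyPresentable

open Cardinal

attribute [local instance] fact_isRegular_aleph0

variable (Λ : Type u) [Ring Λ]

instance isFinitelyPresentable_of_self :
    IsFinitelyPresentable.{u} (ModuleCat.of Λ Λ : ModuleCat.{u} Λ) := by
  rw [isFinitelyPresentable_iff_preservesFilteredColimits]
  let e : forget (ModuleCat.{u} Λ) ≅ coyoneda.obj (Opposite.op (ModuleCat.of Λ Λ)) :=
    NatIso.ofComponents (fun X ↦ Equiv.toIso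
      ((LinearMap.ringLmapEquivSelf Λ ℕ X).toEquiv.symm.trans
        (ModuleCat.homEquiv (M := ModuleCat.of Λ Λ) (N := X)).symm)) (by
        intro X Y f
        ext x
        apply ModuleCat.hom_ext
        ext
        simp [ModuleCat.homEquiv])
  exact ⟨fun J _ _ ↦ preservesColimitsOfShape_of_natIso e⟩

lemma isStrongGenerator_self :
    (ObjectProperty.singleton (ModuleCat.of Λ Λ : ModuleCat.{u} Λ)).IsStrongGenerator := by
  rw [ObjectProperty.isStrongGenerator_iff]
  refine ⟨?_, ?_⟩
  · intro X Y f g h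
    ext x
    have := congr($(h (ModuleCat.of Λ Λ) (by simp)
      (ModuleCat.ofHom (LinearMap.toSpanSingleton Λ X x))).hom 1)
    simpa using this
  · intro X Y i _ h
    rw [ConcreteCategory.isIso_iff_bijective]
    refine ⟨(ModuleCat.mono_iff_injective i).1 inferInstance, fun y ↦ ?_⟩
    obtain ⟨f, hf⟩ := h (ModuleCat.of Λ Λ) (by simp)
      (ModuleCat.ofHom (LinearMap.toSpanSingleton Λ Y y))
    refine ⟨f.hom 1, ?_⟩
    have := congr($(hf).hom 1)
    simpa using this

instance isLocallyFinitelyPresentable_moduleCat :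
    IsLocallyFinitelyPresentable.{u} (ModuleCat.{u} Λ) :=
  (IsCardinalLocallyPresentable.iff_exists_isStrongGenerator _ _).2
    ⟨ObjectProperty.singleton (ModuleCat.of Λ Λ), inferInstance, isStrongGenerator_self Λ, by
      rintro X ⟨⟩; exact isFinitelyPresentable_of_self Λ⟩

variable {Λ}

/-- Λ is a strong generator, so the finitely presentable objects form its closure under finite
colimits, and finitely generated modules are closed under those. With the converse below, this lets
finitely generated modules serve as test objects for `lim M`. -/
lemma finite_of_isFinitelyPresentable (X : ModuleCat.{u} Λ) [IsFinitelyPresentable.{u} X] :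
    Module.Finite Λ X := by
  have hs : (ObjectProperty.singleton (ModuleCat.of Λ Λ)).IsStrongGenerator :=
    isStrongGenerator_self Λ
  have hX : isCardinalPresentable (ModuleCat.{u} Λ) ℵ₀ X := ‹IsFinitelyPresentable.{u} X›
  rw [IsStrongGenerator.colimitsCardinalClosure_eq_isCardinalPresentable hs
    (by rintro X ⟨⟩; exact isFinitelyPresentable_of_self Λ)] at hX
  have : (ModuleCat.isFG.{u} Λ).IsClosedUnderIsomorphisms :=
    ⟨fun e h ↦ (Module.Finite.equiv_iff e.toLinearEquiv).1 h⟩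
  refine ObjectProperty.colimitsCardinalClosure_le _ ℵ₀ (Q := ModuleCat.isFG.{u} Λ) ?_ ?_ _ hX
  · intro J _ hJ
    have : Finite J := (hasCardinalLT_aleph0_iff _).1 (hasCardinalLT_of_hasCardinalLT_arrow hJ)
    refine ⟨fun Y ⟨p⟩ ↦ ?_⟩
    let N : Submodule Λ Y := ⨆ j, LinearMap.range (p.ι.app j).hom
    have hN : N.FG := Submodule.fg_iSup _ fun j ↦ by
      have : Module.Finite Λ (p.diag.obj j) := p.prop_diag_obj j
      rw [LinearMap.range_eq_map]
      exact Module.Finite.fg_top.map _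
    have hmk : ModuleCat.ofHom N.mkQ = 0 := p.isColimit.hom_ext fun j ↦ by
      ext x
      exact (Submodule.Quotient.mk_eq_zero N).2 (Submodule.mem_iSup_of_mem j ⟨x, rfl⟩)
    have htop : N = ⊤ := by
      rw [← Submodule.ker_mkQ N, LinearMap.ker_eq_top]
      exact congr($(hmk).hom)
    exact ⟨htop ▸ hN⟩
  · rintro X ⟨⟩
    exact Module.Finite.self Λ

/-- Over a noetherian ring such a module is the cokernel of a map Λ^m → Λ^n, hence a finite colimit
of copies of Λ. -/
lemma isFinitelyPresentable_of_finite [IsNoetherianRing Λ] (X : ModuleCat.{u} Λ)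
    [Module.Finite Λ X] : IsFinitelyPresentable.{u} X := by
  have hcl {J : Type} [SmallCategory J] [FinCategory J] :
      (isCardinalPresentable (ModuleCat.{u} Λ) ℵ₀).IsClosedUnderColimitsOfShape J := by
    have hJ : Finite (Arrow J) := inferInstance
    exact isClosedUnderColimitsOfShape_isCardinalPresentable _ ((hasCardinalLT_aleph0_iff _).2 hJ)
  have hpi (n : ℕ) : IsFinitelyPresentable.{u} (ModuleCat.of Λ (Fin n → Λ) : ModuleCat.{u} Λ) := by
    have := hcl (J := Discrete (Fin n))
    have h2 := (isCardinalPresentable (ModuleCat.{u} Λ) ℵ₀).prop_of_isColimit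
      (biproduct.isColimit (fun _ : Fin n ↦ ModuleCat.of Λ Λ))
      (fun _ ↦ isFinitelyPresentable_of_self Λ)
    have : IsCardinalPresentable.{u} (⨁ fun _ : Fin n ↦ ModuleCat.of Λ Λ) ℵ₀ := h2
    exact isCardinalPresentable_of_iso
      (ModuleCat.biproductIsoPi (fun _ : Fin n ↦ (ModuleCat.of Λ Λ : ModuleCat.{u} Λ))) ℵ₀
  obtain ⟨n, K, ⟨e⟩⟩ := Module.Finite.exists_fin_quot_equiv Λ X
  obtain ⟨m, f, hf⟩ := Module.Finite.exists_fin' Λ K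
  let φ : ModuleCat.of Λ (Fin m → Λ) ⟶ ModuleCat.of Λ (Fin n → Λ) :=
    ModuleCat.ofHom (K.subtype ∘ₗ f)
  have hK : LinearMap.range φ.hom = K := by
    simp [φ, LinearMap.range_comp, LinearMap.range_eq_top.2 hf]
  have := hcl (J := WalkingParallelPair)
  have h2 := (isCardinalPresentable (ModuleCat.{u} Λ) ℵ₀).prop_of_isColimit
    (ModuleCat.cokernelIsColimit φ) (by rintro (_ | _) <;> exact hpi _)
  have : IsCardinalPresentable.{u} (ModuleCat.of Λ ((Fin n → Λ) ⧸ LinearMap.range φ.hom)) ℵ₀ := h2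
  exact isCardinalPresentable_of_iso (LinearEquiv.toModuleIso
    ((Submodule.quotEquivOfEq _ _ hK).trans e)) ℵ₀

end FinitelyPresentable

/-! ### Short exact sequences of modules -/

section ShortExact

variable {Λ : Type u} [Ring Λ]

lemma shortExact_moduleCat {A B C : Type u} [AddCommGroup A] [AddCommGroup B] [AddCommGroup C]
    [Module Λ A] [Module Λ B] [Module Λ C] {f : A →ₗ[Λ] B} {g : B →ₗ[Λ] C}
    (hf : Function.Injective f) (hg : Function.Surjective g) (h : Function.Exact f g) :
    (ShortComplex.mk (ModuleCat.ofHom f) (ModuleCat.ofHom g)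
      (ModuleCat.hom_ext h.linearMap_comp_eq_zero)).ShortExact :=
  ModuleCat.shortComplex_shortExact _ h hf hg

lemma shortExact_subtype_mkQ {B : Type u} [AddCommGroup B] [Module Λ B] (N : Submodule Λ B) :
    (ShortComplex.mk (ModuleCat.ofHom N.subtype) (ModuleCat.ofHom N.mkQ)
      (ModuleCat.hom_ext (LinearMap.exact_subtype_mkQ N).linearMap_comp_eq_zero)).ShortExact :=
  shortExact_moduleCat N.subtype_injective N.mkQ_surjective (LinearMap.exact_subtype_mkQ N)

lemma shortExact_ker_subtype {B C : Type u} [AddCommGroup B] [AddCommGroup C]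
    [Module Λ B] [Module Λ C] {g : B →ₗ[Λ] C} (hg : Function.Surjective g) :
    (ShortComplex.mk (ModuleCat.ofHom (LinearMap.ker g).subtype) (ModuleCat.ofHom g)
      (ModuleCat.hom_ext (LinearMap.exact_subtype_ker_map g).linearMap_comp_eq_zero)).ShortExact :=
  shortExact_moduleCat (Submodule.subtype_injective _) hg (LinearMap.exact_subtype_ker_map g)

lemma shortExact_fgModuleCat [IsNoetherianRing Λ] {S : ShortComplex (FGModuleCat.{u} Λ)}
    (hf : Function.Injective S.f.hom.hom) (hg : Function.Surjective S.g.hom.hom)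
    (h : Function.Exact S.f.hom.hom S.g.hom.hom) : S.ShortExact := by
  let F := forget₂ (FGModuleCat.{u} Λ) (ModuleCat.{u} Λ)
  have hS : (S.map F).ShortExact :=
    ModuleCat.shortComplex_shortExact _ h hf hg
  have := hS.mono_f
  have := hS.epi_g
  exact
    { exact := (S.exact_map_iff_of_faithful F).1 hS.exact
      mono_f := F.mono_of_mono_map hS.mono_f
      epi_g := F.epi_of_epi_map hS.epi_g }

lemma fgModuleCat_injective_of_mono [IsNoetherianRing Λ] {X Y : FGModuleCat.{u} Λ} (f : X ⟶ Y)
    [Mono f] : Function.Injective f.hom.hom := by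
  have : Mono ((forget₂ (FGModuleCat.{u} Λ) (ModuleCat.{u} Λ)).map f) := inferInstance
  exact (ModuleCat.mono_iff_injective _).1 this

lemma fgModuleCat_surjective_of_epi [IsNoetherianRing Λ] {X Y : FGModuleCat.{u} Λ} (f : X ⟶ Y)
    [Epi f] : Function.Surjective f.hom.hom := by
  have : Epi ((forget₂ (FGModuleCat.{u} Λ) (ModuleCat.{u} Λ)).map f) := inferInstance
  exact (ModuleCat.epi_iff_surjective _).1 this

instance projective_fgModuleCat [IsNoetherianRing Λ] {P : Type u} [AddCommGroup P] [Module Λ P] [Module.Finite Λ P]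
    [Module.Projective Λ P] : Projective (FGModuleCat.of Λ P) where
  factors {E X} f e _ := by
    obtain ⟨h, hh⟩ := Module.projective_lifting_property e.hom.hom f.hom.hom
      (fgModuleCat_surjective_of_epi e)
    exact ⟨FGModuleCat.ofHom h, FGModuleCat.hom_ext hh⟩

end ShortExact

/-! ### Comparison of the Ext groups of `Λ`-mod and of `Λ`-Mod -/

section Comparison

variable {Λ : Type u} [Ring Λ]

lemma shortExact_directSum {ι : Type u} {P X : ι → Type u} [∀ i, AddCommGroup (P i)]
    [∀ i, Module Λ (P i)] [∀ i, AddCommGroup (X i)] [∀ i, Module Λ (X i)]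
    {g : ∀ i, P i →ₗ[Λ] X i} (hg : ∀ i, Function.Surjective (g i)) :
    ∃ w, (ShortComplex.mk (C := ModuleCat.{u} Λ)
      (X₁ := ModuleCat.of Λ (DirectSum ι fun i ↦ LinearMap.ker (g i)))
      (X₂ := ModuleCat.of Λ (DirectSum ι P)) (X₃ := ModuleCat.of Λ (DirectSum ι X))
      (ModuleCat.ofHom (DirectSum.lmap fun i ↦ (LinearMap.ker (g i)).subtype))
      (ModuleCat.ofHom (DirectSum.lmap g)) w).ShortExact :=
  ⟨_, shortExact_moduleCat (A := DirectSum ι fun i ↦ LinearMap.ker (g i)) (B := DirectSum ι P)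
      (C := DirectSum ι X) (f := DirectSum.lmap fun i ↦ (LinearMap.ker (g i)).subtype)
      (g := DirectSum.lmap g)
      ((DirectSum.lmap_injective _).2 fun i ↦ Submodule.subtype_injective _)
      ((DirectSum.lmap_surjective _).2 hg)
      (LinearMap.exact_iff.2 (by rw [DirectSum.ker_lmap, DirectSum.range_lmap]; simp))⟩

/-- Dimension shifting along the direct sum of the free covers `X i →₀ Λ`, whose kernel is the
direct sum of the kernels. In degree one, extensions chosen on the summands glue. -/
lemma extVanishes_directSum {ι : Type u} (X : ι → Type u) [∀ i, AddCommGroup (X i)]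
    [∀ i, Module Λ (X i)] (Y : ModuleCat.{u} Λ) {k : ℕ} (hk : 0 < k)
    (h : ∀ i, ExtVanishes (ModuleCat.of Λ (X i)) Y k) :
    ExtVanishes (ModuleCat.of Λ (DirectSum ι X)) Y k := by
  obtain ⟨k, rfl⟩ := Nat.exists_eq_succ_of_ne_zero hk.ne'
  clear hk
  classical
  induction k generalizing X with
  | zero =>
    have hg i : Function.Surjective (Finsupp.linearCombination Λ (id : X i → X i)) :=
      Finsupp.linearCombination_id_surjective Λ (X i)
    obtain ⟨w, hS⟩ := shortExact_directSum hg
    have := Module.Projective.directSum (R := Λ) (ι := ι) (M := fun i ↦ X i →₀ Λ)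
    refine extVanishes_one_of_extension hS (extVanishes_of_projective _ _ _ one_pos) ?_
    intro f
    have hi i := (h i).exists_extension (shortExact_ker_subtype (hg i))
      (ModuleCat.ofHom (f.hom ∘ₗ DirectSum.lof Λ ι
        (fun i ↦ LinearMap.ker (Finsupp.linearCombination Λ (id : X i → X i))) i))
    choose φ hφ using hi
    refine ⟨ModuleCat.ofHom (DirectSum.toModule Λ ι Y fun i ↦ (φ i).hom), ?_⟩
    apply ModuleCat.hom_ext
    refine DirectSum.linearMap_ext _ fun i ↦ ?_
    ext x
    simpa using congr(($(hφ i)).hom x)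
  | succ k ih =>
    have hg i : Function.Surjective (Finsupp.linearCombination Λ (id : X i → X i)) :=
      Finsupp.linearCombination_id_surjective Λ (X i)
    obtain ⟨w, hS⟩ := shortExact_directSum hg
    have := Module.Projective.directSum (R := Λ) (ι := ι) (M := fun i ↦ X i →₀ Λ)
    exact .of_shortExact_left_last hS (ih _ fun i ↦ .of_shortExact_left
      (shortExact_ker_subtype (hg i)) (extVanishes_of_projective _ _ _ (by lia)) (h i))
      (extVanishes_of_projective _ _ _ (by lia))

variable [IsNoetherianRing Λ]

lemma shortExact_fg_ker {X : Type u} [AddCommGroup X] [Module Λ X] [Module.Finite Λ X] {k : ℕ}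
    {g : (Fin k → Λ) →ₗ[Λ] X} (hg : Function.Surjective g) :
    (ShortComplex.mk (FGModuleCat.ofHom (LinearMap.ker g).subtype) (FGModuleCat.ofHom g)
      (FGModuleCat.hom_ext
        (LinearMap.exact_subtype_ker_map g).linearMap_comp_eq_zero)).ShortExact :=
  shortExact_fgModuleCat (Submodule.subtype_injective _) hg (LinearMap.exact_subtype_ker_map g)

end Comparison

/-! ### Cluster tilting subcategories of `Λ`-mod -/

section ModuleClosure

variable {Λ : Type u} [Ring Λ] [IsNoetherianRing Λ] {M : ObjectProperty (FGModuleCat.{u} Λ)}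
  {n : ℕ} (hM : IsNClusterTilting n M)

include hM

/-- `M` is its own left perpendicular, and Ext-vanishing passes along a decomposition of the
identity. This form covers summands and finite products at once. -/
lemma IsNClusterTilting.mem_of_sum_eq_id {X : FGModuleCat.{u} Λ} {ι : Type*} [Fintype ι]
    {Z : ι → FGModuleCat.{u} Λ} (hZ : ∀ j, M (Z j)) (p : ∀ j, X.obj →ₗ[Λ] (Z j).obj)
    (q : ∀ j, (Z j).obj →ₗ[Λ] X.obj) (h : ∑ j, q j ∘ₗ p j = LinearMap.id) : M X := by
  rw [← hM.leftPerp_eq]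
  intro i hi hin Y hY
  refine .of_sum_eq_id Z (fun j ↦ FGModuleCat.ofHom (p j)) (fun j ↦ FGModuleCat.ofHom (q j)) ?_
    fun j ↦ ?_
  · apply (ModuleCat.isFG.{u} Λ).ι.map_injective
    rw [Functor.map_sum]
    apply ModuleCat.hom_ext
    rw [ModuleCat.hom_sum]
    exact h
  · have := hZ j
    rw [← hM.leftPerp_eq] at this
    exact this i hi hin Y hY

lemma IsNClusterTilting.mem_of_retract {X Z : FGModuleCat.{u} Λ} (hZ : M Z)
    (p : X.obj →ₗ[Λ] Z.obj) (q : Z.obj →ₗ[Λ] X.obj) (h : q ∘ₗ p = LinearMap.id) : M X :=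
  hM.mem_of_sum_eq_id (ι := Unit) (fun _ ↦ hZ) (fun _ ↦ p) (fun _ ↦ q) (by simpa using h)

lemma IsNClusterTilting.mem_pi {ι : Type u} [Finite ι] {Z : ι → FGModuleCat.{u} Λ}
    (hZ : ∀ j, M (Z j)) : M (FGModuleCat.of Λ (∀ j, (Z j).obj)) := by
  classical
  have := Fintype.ofFinite ι
  refine hM.mem_of_sum_eq_id hZ (fun j ↦ LinearMap.proj j)
    (fun j ↦ LinearMap.single Λ (fun j ↦ (Z j).obj) j) ?_
  refine LinearMap.ext fun x ↦ ?_
  simp only [LinearMap.sum_apply]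
  exact Finset.univ_sum_single x

lemma IsNClusterTilting.mem_self : M (FGModuleCat.of Λ Λ) := by
  rw [← hM.leftPerp_eq]
  exact fun i hi _ Y _ ↦ extVanishes_of_projective _ _ _ hi

/-- A left approximation is injective because some embedding into an object of `M` factors through
it. -/
lemma IsNClusterTilting.exists_leftApproximation (F : Type u) [AddCommGroup F] [Module Λ F]
    [Module.Finite Λ F] :
    ∃ (U : FGModuleCat.{u} Λ) (θ : F →ₗ[Λ] U.obj), M U ∧ Function.Injective θ ∧
      ∀ V : FGModuleCat.{u} Λ, M V → ∀ g : F →ₗ[Λ] V.obj, ∃ h : U.obj →ₗ[Λ] V.obj, h ∘ₗ θ = g := by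
  obtain ⟨U, θ, hU, hθ⟩ := hM.functoriallyFinite.2 (FGModuleCat.of Λ F)
  obtain ⟨V, j, hV, hj⟩ := hM.cogenerating (FGModuleCat.of Λ F)
  refine ⟨U, θ.hom.hom, hU, ?_, fun V hV g ↦ ?_⟩
  · obtain ⟨g, rfl⟩ := hθ V j hV
    have := fgModuleCat_injective_of_mono (θ ≫ g)
    exact Function.Injective.of_comp (f := g.hom.hom) this
  · obtain ⟨h, hh⟩ := hθ V (FGModuleCat.ofHom g) hV
    exact ⟨h.hom.hom, congr(($hh).hom.hom)⟩

end ModuleClosure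

/-! ### Filtered colimits -/

section DirectSum

variable {Λ : Type u} [Ring Λ]

/-- Every homomorphism from a finitely generated module to a direct sum factors through a finite
subsum. -/
lemma exists_finset_factorization {ι : Type*} [DecidableEq ι] (X : ι → Type*)
    [∀ i, AddCommGroup (X i)] [∀ i, Module Λ (X i)] {F : Type*} [AddCommGroup F] [Module Λ F]
    [Module.Finite Λ F] (f : F →ₗ[Λ] DirectSum ι X) :
    ∃ s : Finset ι, ∀ x, ∑ i ∈ s, DirectSum.lof Λ ι X i (f x i) = f x := by
  obtain ⟨t, ht⟩ := Module.Finite.fg_top (R := Λ) (M := F)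
  classical
  let s : Finset ι := t.biUnion fun x ↦ DFinsupp.support (f x)
  refine ⟨s, fun x ↦ ?_⟩
  have h : (∑ i ∈ s, DirectSum.lof Λ ι X i ∘ₗ DirectSum.component Λ ι X i ∘ₗ f) = f := by
    refine LinearMap.ext_on ht fun y hy ↦ ?_
    simp only [LinearMap.sum_apply, LinearMap.comp_apply]
    conv_rhs => rw [← DirectSum.sum_support_of (f y)]
    refine (Finset.sum_subset (Finset.subset_biUnion_of_mem (fun x ↦ DFinsupp.support (f x)) hy)
      fun i _ hi ↦ ?_).symm
    rw [DFinsupp.notMem_support_iff] at hi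
    exact (congrArg _ hi).trans (map_zero _)
  have h2 := congr($h x)
  rw [LinearMap.sum_apply] at h2
  exact h2

end DirectSum

section Lim

variable {Λ : Type u} [Ring Λ] [IsNoetherianRing Λ] {M : ObjectProperty (FGModuleCat.{u} Λ)}

lemma lim_iff_exists_factorization {C : ModuleCat.{u} Λ} :
    lim M C ↔ ∀ (F : Type u) [AddCommGroup F] [Module Λ F] [Module.Finite Λ F] (f : F →ₗ[Λ] C),
      ∃ (U : FGModuleCat.{u} Λ) (a : F →ₗ[Λ] U.obj) (b : U.obj →ₗ[Λ] C), M U ∧ b ∘ₗ a = f := by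
  have hle : inMod M ≤ ObjectProperty.isFinitelyPresentable.{u} (ModuleCat.{u} Λ) := by
    rintro X ⟨U, hU, ⟨e⟩⟩
    have : Module.Finite Λ X := (Module.Finite.equiv_iff e.toLinearEquiv).1 U.property
    exact isFinitelyPresentable_of_finite X
  refine (ObjectProperty.ind_iff_exists hle).trans ⟨?_, ?_⟩
  · intro h F _ _ _ f
    have := isFinitelyPresentable_of_finite (ModuleCat.of Λ F)
    obtain ⟨W, a, b, hab, U, hU, ⟨e⟩⟩ := h (ModuleCat.ofHom f)
    exact ⟨U, (a ≫ e.inv).hom, (e.hom ≫ b).hom, hU, by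
      rw [← ModuleCat.hom_comp, Category.assoc, e.inv_hom_id_assoc, hab, ModuleCat.hom_ofHom]⟩
  · intro h Z g _
    have := finite_of_isFinitelyPresentable Z
    obtain ⟨U, a, b, hU, hab⟩ := h Z g.hom
    exact ⟨U.obj, ModuleCat.ofHom a, ModuleCat.ofHom b, ModuleCat.hom_ext hab, U, hU,
      ⟨Iso.refl _⟩⟩

lemma lim.exists_factorization {C : Type u} [AddCommGroup C] [Module Λ C]
    (hC : lim M (ModuleCat.of Λ C)) {F : Type u} [AddCommGroup F] [Module Λ F] [Module.Finite Λ F]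
    (f : F →ₗ[Λ] C) :
    ∃ (U : FGModuleCat.{u} Λ) (a : F →ₗ[Λ] U.obj) (b : U.obj →ₗ[Λ] C), M U ∧ b ∘ₗ a = f :=
  lim_iff_exists_factorization.1 hC F f

lemma lim_of_mem {U : FGModuleCat.{u} Λ} (hU : M U) : lim M U.obj :=
  lim_iff_exists_factorization.2 fun _ _ _ _ f ↦ ⟨U, f, LinearMap.id, hU, rfl⟩

/-- If finitely generated modules lift along `π : X ⟶ C`, then `C` is a filtered colimit of
modules in `M` when `X` is. -/
lemma lim.of_lift {X C : Type u} [AddCommGroup X] [Module Λ X] [AddCommGroup C] [Module Λ C]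
    (hX : lim M (ModuleCat.of Λ X)) (π : X →ₗ[Λ] C)
    (h : ∀ (F : Type u) [AddCommGroup F] [Module Λ F] [Module.Finite Λ F] (f : F →ₗ[Λ] C),
      ∃ g : F →ₗ[Λ] X, π ∘ₗ g = f) : lim M (ModuleCat.of Λ C) := by
  refine lim_iff_exists_factorization.2 fun F _ _ _ f ↦ ?_
  obtain ⟨g, rfl⟩ := h F f
  obtain ⟨U, a, b, hU, rfl⟩ := hX.exists_factorization g
  exact ⟨U, a, π ∘ₗ b, hU, rfl⟩

lemma lim.of_retract {X C : Type u} [AddCommGroup X] [Module Λ X] [AddCommGroup C] [Module Λ C]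
    (hX : lim M (ModuleCat.of Λ X)) (i : C →ₗ[Λ] X) (r : X →ₗ[Λ] C) (h : r ∘ₗ i = LinearMap.id) :
    lim M (ModuleCat.of Λ C) :=
  hX.of_lift r fun F _ _ _ f ↦ ⟨i ∘ₗ f, by rw [← LinearMap.comp_assoc, h, LinearMap.id_comp]⟩

lemma lim.quotient {X : Type u} [AddCommGroup X] [Module Λ X]
    (hX : lim M (ModuleCat.of Λ X)) {N : Submodule Λ X} (hN : IsPureSubmodule N) :
    lim M (ModuleCat.of Λ (X ⧸ N)) :=
  hX.of_lift N.mkQ fun F _ _ _ f ↦ by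
    have := Module.finitePresentation_of_finite Λ F
    exact hN F f

variable {n : ℕ} (hM : IsNClusterTilting n M)

include hM

/-- Unlike the factorization criterion, where the intermediate object depends on the morphism, this
one fixes the approximation `θ`; extensions can therefore be chosen coordinatewise in a product, or
corrected to land in a pure submodule. -/
lemma IsNClusterTilting.lim_iff_extension {C : Type u} [AddCommGroup C] [Module Λ C] :
    lim M (ModuleCat.of Λ C) ↔ ∀ (F : Type u) [AddCommGroup F] [Module Λ F] [Module.Finite Λ F]
      (U : FGModuleCat.{u} Λ) (θ : F →ₗ[Λ] U.obj), M U → (∀ V : FGModuleCat.{u} Λ, M V →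
        ∀ g : F →ₗ[Λ] V.obj, ∃ h : U.obj →ₗ[Λ] V.obj, h ∘ₗ θ = g) →
      ∀ f : F →ₗ[Λ] C, ∃ h : U.obj →ₗ[Λ] C, h ∘ₗ θ = f := by
  constructor
  · intro hC F _ _ _ U θ hU hθ f
    obtain ⟨V, a, b, hV, rfl⟩ := hC.exists_factorization f
    obtain ⟨h, rfl⟩ := hθ V hV a
    exact ⟨b ∘ₗ h, rfl⟩
  · intro h
    refine lim_iff_exists_factorization.2 fun F _ _ _ f ↦ ?_
    obtain ⟨U, θ, hU, -, hθ⟩ := hM.exists_leftApproximation F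
    obtain ⟨b, hb⟩ := h F U θ hU hθ f
    exact ⟨U, θ, b, hU, hb⟩

lemma IsNClusterTilting.lim_pi {ι : Type u} {X : ι → Type u} [∀ i, AddCommGroup (X i)]
    [∀ i, Module Λ (X i)] (hX : ∀ i, lim M (ModuleCat.of Λ (X i))) :
    lim M (ModuleCat.of Λ (∀ i, X i)) := by
  refine hM.lim_iff_extension.2 fun F _ _ _ U θ hU hθ f ↦ ?_
  have h i := hM.lim_iff_extension.1 (hX i) F U θ hU hθ (LinearMap.proj i ∘ₗ f)
  choose g hg using h
  exact ⟨LinearMap.pi g, LinearMap.ext fun x ↦ funext fun i ↦ congr($(hg i) x)⟩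

lemma IsNClusterTilting.lim_directSum {ι : Type u} {U : ι → FGModuleCat.{u} Λ}
    (hU : ∀ i, M (U i)) : lim M (ModuleCat.of Λ (DirectSum ι fun i ↦ (U i).obj)) := by
  classical
  refine lim_iff_exists_factorization.2 fun F _ _ _ f ↦ ?_
  obtain ⟨s, hs⟩ := exists_finset_factorization (fun i ↦ (U i).obj) f
  refine ⟨FGModuleCat.of Λ (∀ i : s, (U i).obj),
    LinearMap.pi fun i ↦ DirectSum.component Λ ι (fun i ↦ (U i).obj) i ∘ₗ f,
    ∑ i : s, DirectSum.lof Λ ι (fun i ↦ (U i).obj) i ∘ₗ LinearMap.proj i,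
    hM.mem_pi fun i ↦ hU i, ?_⟩
  refine LinearMap.ext fun x ↦ ?_
  simp only [LinearMap.comp_apply, LinearMap.sum_apply]
  refine Eq.trans ?_ (hs x)
  exact Finset.sum_coe_sort s fun i ↦ DirectSum.lof Λ ι (fun i ↦ (U i).obj) i (f x i)

lemma IsNClusterTilting.add_le_lim : Add M ≤ lim M := by
  rintro X ⟨ι, U, hU, ⟨r⟩⟩
  exact (hM.lim_directSum hU).of_retract r.i.hom r.r.hom congr(($(r.retract)).hom)

lemma IsNClusterTilting.lim_of_isPureSubmodule {X : Type u} [AddCommGroup X] [Module Λ X]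
    (hX : lim M (ModuleCat.of Λ X)) {N : Submodule Λ X} (hN : IsPureSubmodule N) :
    lim M (ModuleCat.of Λ N) := by
  refine hM.lim_iff_extension.2 fun F _ _ _ U θ hU hθ f ↦ ?_
  obtain ⟨h, hh⟩ := hM.lim_iff_extension.1 hX F U θ hU hθ (N.subtype ∘ₗ f)
  let Q := U.obj ⧸ LinearMap.range θ
  have hle : LinearMap.range θ ≤ LinearMap.ker (N.mkQ ∘ₗ h) := by
    rintro _ ⟨x, rfl⟩
    have := congr($hh x)
    simp only [LinearMap.comp_apply] at this
    simp [this]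
  have : Module.Finite Λ U.obj := U.property
  have : Module.FinitePresentation Λ Q := Module.finitePresentation_of_finite Λ Q
  obtain ⟨g, hg⟩ := hN Q ((LinearMap.range θ).liftQ (N.mkQ ∘ₗ h) hle)
  -- Modulo `N`, the extension `h` kills the image of `θ`, so it factors through the finitely
  -- presented cokernel and lifts by purity. Subtracting the lift moves `h` into `N` without
  -- changing it on that image.
  let k : U.obj →ₗ[Λ] X := h - g ∘ₗ (LinearMap.range θ).mkQ
  have hk x : k x ∈ N := by
    rw [← Submodule.Quotient.mk_eq_zero, ← Submodule.mkQ_apply]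
    have := congr($hg ((LinearMap.range θ).mkQ x))
    simp only [LinearMap.comp_apply, Submodule.mkQ_apply, Submodule.liftQ_apply] at this
    rw [LinearMap.sub_apply, LinearMap.comp_apply, Submodule.mkQ_apply, Submodule.mkQ_apply,
      Submodule.Quotient.mk_sub, this, sub_self]
  refine ⟨k.codRestrict N hk, LinearMap.ext fun x ↦ Subtype.ext ?_⟩
  have h1 := congr($hh x)
  have h2 : (LinearMap.range θ).mkQ (θ x) = 0 := by simp
  simp only [LinearMap.comp_apply] at h1
  simp only [k, LinearMap.comp_apply, LinearMap.codRestrict_apply, LinearMap.sub_apply, h1, h2,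
    map_zero, sub_zero, Submodule.subtype_apply]

end Lim

/-! ### Filtered colimits and Ext -/

section LimExt

variable {Λ : Type u} [Ring Λ] [IsNoetherianRing Λ] {M : ObjectProperty (FGModuleCat.{u} Λ)}

/-- In degree one, a morphism from the finitely generated syzygy of `Z` to `C` factors through some
`U` in `M`, where it extends over the free cover. Higher degrees follow by passing to syzygies. -/
lemma extVanishes_of_lim (Z : Type u) [AddCommGroup Z] [Module Λ Z] [Module.Finite Λ Z] {i : ℕ}
    (hi : 0 < i) (h : ∀ U : FGModuleCat.{u} Λ, M U → ExtVanishes (FGModuleCat.of Λ Z) U i)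
    {C : ModuleCat.{u} Λ} (hC : lim M C) : ExtVanishes (ModuleCat.of Λ Z) C i := by
  obtain ⟨i, rfl⟩ := Nat.exists_eq_succ_of_ne_zero hi.ne'
  clear hi
  induction i generalizing Z with
  | zero =>
    obtain ⟨k, g, hg⟩ := Module.Finite.exists_fin' Λ Z
    refine (extVanishes_one_iff_of_projective (shortExact_ker_subtype hg)).2 fun f ↦ ?_
    obtain ⟨U, a, b, hU, hab⟩ := lim.exists_factorization (C := C) hC f.hom
    obtain ⟨c, hc⟩ := (h U hU).exists_extension (shortExact_fg_ker hg) (FGModuleCat.ofHom a)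
    refine ⟨ModuleCat.ofHom (b ∘ₗ c.hom.hom), ModuleCat.hom_ext ?_⟩
    rw [← hab]
    exact congrArg (b ∘ₗ ·) congr(($hc).hom.hom)
  | succ i ih =>
    obtain ⟨k, g, hg⟩ := Module.Finite.exists_fin' Λ Z
    exact (extVanishes_add_two_iff_of_projective (shortExact_ker_subtype hg)).2 <| ih _ fun U hU ↦
      (extVanishes_add_two_iff_of_projective (shortExact_fg_ker hg)).1 (h U hU)

variable {n : ℕ} (hM : IsNClusterTilting n M)

include hM

lemma IsNClusterTilting.extVanishes {U V : FGModuleCat.{u} Λ} (hU : M U) (hV : M V) {i : ℕ}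
    (hi : 0 < i) (hin : i < n) : ExtVanishes U V i := by
  rw [← hM.leftPerp_eq] at hU
  exact hU i hi hin V hV

lemma IsNClusterTilting.extVanishes_lim {U : FGModuleCat.{u} Λ} (hU : M U) {C : ModuleCat.{u} Λ}
    (hC : lim M C) {i : ℕ} (hi : 0 < i) (hin : i < n) : ExtVanishes U.obj C i :=
  have : Module.Finite Λ U.obj := U.property
  extVanishes_of_lim U.obj hi (fun _ hV ↦ hM.extVanishes hU hV hi hin) hC

lemma IsNClusterTilting.extVanishes_add {X C : ModuleCat.{u} Λ} (hX : Add M X)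
    (hC : lim M C) {i : ℕ} (hi : 0 < i) (hin : i < n) : ExtVanishes X C i := by
  obtain ⟨ι, U, hU, ⟨r⟩⟩ := hX
  exact .of_retract r (extVanishes_directSum _ _ hi fun j ↦ hM.extVanishes_lim (hU j) hC hi hin)

/-- The cokernel of a left approximation of a module `Z` with `Ext^i(Z, M) = 0` for `0 < i ≤ j`
satisfies the same condition for `0 < i ≤ j + 1`. -/
lemma IsNClusterTilting.extVanishes_cokernel {Z : Type u} [AddCommGroup Z] [Module Λ Z]
    [Module.Finite Λ Z] {j : ℕ} (hjn : j + 1 < n)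
    (hZ : ∀ i, 0 < i → i ≤ j → ∀ V : FGModuleCat.{u} Λ, M V →
      ExtVanishes (FGModuleCat.of Λ Z) V i)
    {U : FGModuleCat.{u} Λ} (hU : M U) {θ : Z →ₗ[Λ] U.obj} (hinj : Function.Injective θ)
    (hθ : ∀ V : FGModuleCat.{u} Λ, M V → ∀ g : Z →ₗ[Λ] V.obj, ∃ h : U.obj →ₗ[Λ] V.obj, h ∘ₗ θ = g)
    [Module.Finite Λ U.obj] {i : ℕ} (hi : 0 < i) (hij : i ≤ j + 1) {V : FGModuleCat.{u} Λ}
    (hV : M V) : ExtVanishes (FGModuleCat.of Λ (U.obj ⧸ LinearMap.range θ)) V i := by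
  have hS : (ShortComplex.mk (FGModuleCat.ofHom θ)
      (FGModuleCat.ofHom (LinearMap.range θ).mkQ)
      (FGModuleCat.hom_ext (LinearMap.exact_map_mkQ_range θ).linearMap_comp_eq_zero)).ShortExact :=
    shortExact_fgModuleCat hinj (Submodule.mkQ_surjective _) (LinearMap.exact_map_mkQ_range θ)
  obtain ⟨i, rfl⟩ := Nat.exists_eq_succ_of_ne_zero hi.ne'
  rcases Nat.eq_zero_or_pos i with rfl | hi'
  · refine extVanishes_one_of_extension hS (hM.extVanishes hU hV hi (by lia)) fun f ↦ ?_
    obtain ⟨h, hh⟩ := hθ V hV f.hom.hom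
    exact ⟨FGModuleCat.ofHom h, FGModuleCat.hom_ext hh⟩
  · exact .of_shortExact_left_last hS (hZ i hi' (by lia) V hV) (hM.extVanishes hU hV hi (by lia))

/-- It suffices that Ext^1(Z, C) = 0 for cokernels `Z` of left approximations, since then morphisms
to `C` extend. Each further cokernel gains one degree of orthogonality to `M`, until degree `n - 1`
puts it in `M`; `key` descends from there, with `d` counting the missing degrees. -/
lemma IsNClusterTilting.lim_of_extVanishes (hn : 2 ≤ n) {C : ModuleCat.{u} Λ}
    (h : ∀ i, 0 < i → i < n → ∀ U : FGModuleCat.{u} Λ, M U → ExtVanishes U.obj C i) :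
    lim M C := by
  have key (d : ℕ) : ∀ (j : ℕ) (_ : 0 < j) (_ : j + d + 1 = n) (Z : Type u) [AddCommGroup Z]
      [Module Λ Z] [Module.Finite Λ Z] (_ : ∀ i, 0 < i → i ≤ j → ∀ V : FGModuleCat.{u} Λ, M V →
        ExtVanishes (FGModuleCat.of Λ Z) V i), ExtVanishes (ModuleCat.of Λ Z) C j := by
    induction d with
    | zero =>
      intro j hj hjn Z _ _ _ hZ
      have hZM : M (FGModuleCat.of Λ Z) := by
        rw [← hM.leftPerp_eq]
        exact fun i hi hin V hV ↦ hZ i hi (by lia) V hV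
      exact h j hj (by lia) _ hZM
    | succ d ih =>
      intro j hj hjn Z _ _ _ hZ
      obtain ⟨U, θ, hU, hinj, hθ⟩ := hM.exists_leftApproximation Z
      have : Module.Finite Λ U.obj := U.property
      have h1 := ih (j + 1) (by lia) (by lia) (U.obj ⧸ LinearMap.range θ) fun i hi hij V hV ↦
        hM.extVanishes_cokernel (by lia) hZ hU hinj hθ hi hij hV
      exact .of_shortExact_left (shortExact_moduleCat hinj (Submodule.mkQ_surjective _)
        (LinearMap.exact_map_mkQ_range θ)) (h j hj (by lia) U hU) h1
  refine lim_iff_exists_factorization.2 fun F _ _ _ f ↦ ?_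
  obtain ⟨U, θ, hU, hinj, hθ⟩ := hM.exists_leftApproximation F
  have : Module.Finite Λ U.obj := U.property
  have h1 := key (n - 2) 1 one_pos (by lia) (U.obj ⧸ LinearMap.range θ) fun i hi hij V hV ↦
    hM.extVanishes_cokernel (j := 0) (by lia) (by lia) hU hinj hθ hi hij hV
  obtain ⟨g, hg⟩ := h1.exists_extension (shortExact_moduleCat hinj (Submodule.mkQ_surjective _)
    (LinearMap.exact_map_mkQ_range θ)) (ModuleCat.ofHom f)
  exact ⟨U, θ, g.hom, hU, congr(($hg).hom)⟩

end LimExt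

/-! ### Approximations by direct sums and products -/

section Approximation

variable {Λ : Type u} [Ring Λ] [IsNoetherianRing Λ] {M : ObjectProperty (FGModuleCat.{u} Λ)}
variable {n : ℕ} (hM : IsNClusterTilting n M)

include hM

/-- A small set of representatives of the isomorphism classes of `M`. -/
lemma IsNClusterTilting.exists_representatives :
    ∃ (ι : Type u) (U : ι → FGModuleCat.{u} Λ), (∀ i, M (U i)) ∧
      ∀ V : FGModuleCat.{u} Λ, M V → ∃ i, Nonempty (V.obj ≃ₗ[Λ] (U i).obj) := by
  refine ⟨Σ k : ℕ, {N : Submodule Λ (Fin k → Λ) // M (FGModuleCat.of Λ ((Fin k → Λ) ⧸ N))},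
    fun i ↦ FGModuleCat.of Λ ((Fin i.1 → Λ) ⧸ i.2.1), fun i ↦ i.2.2, fun V hV ↦ ?_⟩
  have : Module.Finite Λ V.obj := V.property
  obtain ⟨k, N, ⟨e⟩⟩ := Module.Finite.exists_fin_quot_equiv Λ V.obj
  exact ⟨⟨k, N, hM.mem_of_retract (X := FGModuleCat.of Λ ((Fin k → Λ) ⧸ N)) hV e.toLinearMap
    e.symm.toLinearMap (by ext; simp)⟩, ⟨e.symm⟩⟩

/-- The index set consists of all morphisms to `K` from representatives of the isomorphism classes
of `M`. -/
lemma IsNClusterTilting.exists_directSum_approximation (K : Type u) [AddCommGroup K]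
    [Module Λ K] :
    ∃ (ι : Type u) (U : ι → FGModuleCat.{u} Λ) (π : DirectSum ι (fun i ↦ (U i).obj) →ₗ[Λ] K),
      (∀ i, M (U i)) ∧ ∀ V : FGModuleCat.{u} Λ, M V → ∀ f : V.obj →ₗ[Λ] K,
        ∃ g : V.obj →ₗ[Λ] DirectSum ι (fun i ↦ (U i).obj), π ∘ₗ g = f := by
  classical
  obtain ⟨ι, U, hU, h⟩ := hM.exists_representatives
  refine ⟨Σ i, (U i).obj →ₗ[Λ] K, fun i ↦ U i.1, DirectSum.toModule Λ _ K fun i ↦ i.2,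
    fun i ↦ hU i.1, fun V hV f ↦ ?_⟩
  obtain ⟨i, ⟨e⟩⟩ := h V hV
  refine ⟨DirectSum.lof Λ (Σ i, (U i).obj →ₗ[Λ] K) (fun i ↦ (U i.1).obj)
    ⟨i, f ∘ₗ e.symm.toLinearMap⟩ ∘ₗ e.toLinearMap, LinearMap.ext fun x ↦ ?_⟩
  simp only [LinearMap.comp_apply, DirectSum.toModule_lof]
  simp

lemma IsNClusterTilting.exists_pi_approximation (K : Type u) [AddCommGroup K] [Module Λ K] :
    ∃ (ι : Type u) (U : ι → FGModuleCat.{u} Λ) (θ : K →ₗ[Λ] ∀ i, (U i).obj),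
      (∀ i, M (U i)) ∧ ∀ V : FGModuleCat.{u} Λ, M V → ∀ f : K →ₗ[Λ] V.obj,
        ∃ g : (∀ i, (U i).obj) →ₗ[Λ] V.obj, g ∘ₗ θ = f := by
  obtain ⟨ι, U, hU, h⟩ := hM.exists_representatives
  refine ⟨Σ i, K →ₗ[Λ] (U i).obj, fun i ↦ U i.1, LinearMap.pi fun i ↦ i.2,
    fun i ↦ hU i.1, fun V hV f ↦ ?_⟩
  obtain ⟨i, ⟨e⟩⟩ := h V hV
  refine ⟨e.symm.toLinearMap ∘ₗ LinearMap.proj (R := Λ) (φ := fun i : (Σ i, K →ₗ[Λ] (U i).obj) ↦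
    ((U i.1).obj : Type u)) ⟨i, e.toLinearMap ∘ₗ f⟩, LinearMap.ext fun x ↦ ?_⟩
  simp

lemma IsNClusterTilting.surjective_of_lift {X K : Type u} [AddCommGroup K] [Module Λ K]
    [AddCommGroup X] [Module Λ X] {π : X →ₗ[Λ] K}
    (hπ : ∀ V : FGModuleCat.{u} Λ, M V → ∀ f : V.obj →ₗ[Λ] K,
        ∃ g : V.obj →ₗ[Λ] X, π ∘ₗ g = f) : Function.Surjective π := fun x ↦ by
  obtain ⟨g, hg⟩ := hπ (FGModuleCat.of Λ Λ) hM.mem_self (LinearMap.toSpanSingleton Λ K x)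
  exact ⟨g (1 : Λ), by simpa using congr($hg (1 : Λ))⟩

/-- The kernel of a right approximation of a module `K` with `Ext^i(M, K) = 0` for `0 < i ≤ j`
satisfies the same condition for `0 < i ≤ j + 1`. -/
lemma IsNClusterTilting.extVanishes_ker {X K : Type u} [AddCommGroup K] [Module Λ K]
    [AddCommGroup X] [Module Λ X] (hX : lim M (ModuleCat.of Λ X)) {π : X →ₗ[Λ] K}
    (hπ : ∀ V : FGModuleCat.{u} Λ, M V → ∀ f : V.obj →ₗ[Λ] K,
        ∃ g : V.obj →ₗ[Λ] X, π ∘ₗ g = f) {j : ℕ} (hjn : j + 1 < n)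
    (hK : ∀ i, 0 < i → i ≤ j → ∀ V : FGModuleCat.{u} Λ, M V →
      ExtVanishes V.obj (ModuleCat.of Λ K) i)
    {i : ℕ} (hi : 0 < i) (hij : i ≤ j + 1) {V : FGModuleCat.{u} Λ}
    (hV : M V) : ExtVanishes V.obj (ModuleCat.of Λ (LinearMap.ker π)) i := by
  have hS := shortExact_ker_subtype (hM.surjective_of_lift hπ)
  obtain ⟨i, rfl⟩ := Nat.exists_eq_succ_of_ne_zero hi.ne'
  rcases Nat.eq_zero_or_pos i with rfl | hi'
  · refine extVanishes_one_of_lift hS (hM.extVanishes_lim hV hX hi (by lia)) fun f ↦ ?_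
    obtain ⟨h, hh⟩ := hπ V hV f.hom
    exact ⟨ModuleCat.ofHom h, ModuleCat.hom_ext hh⟩
  · exact .of_shortExact_right_first hS (hK i hi' (by lia) V hV)
      (hM.extVanishes_lim hV hX hi (by lia))

/-- Dual to `lim_of_extVanishes`: iterated kernels of right approximations by direct sums gain
degrees until they lie in `lim M`. Descending, Ext^1 from `X` to the kernel of its own approximation
vanishes, so that approximation splits. -/
lemma IsNClusterTilting.add_of_extVanishes (hn : 2 ≤ n) {X : ModuleCat.{u} Λ}
    (hX : ∀ i, 0 < i → i < n → ∀ Y : ModuleCat.{u} Λ, lim M Y → ExtVanishes X Y i) :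
    Add M X := by
  have key (d : ℕ) : ∀ (j : ℕ) (_ : 0 < j) (_ : j + d + 1 = n) (K : Type u) [AddCommGroup K]
      [Module Λ K] (_ : ∀ i, 0 < i → i ≤ j → ∀ V : FGModuleCat.{u} Λ, M V →
        ExtVanishes V.obj (ModuleCat.of Λ K) i), ExtVanishes X (ModuleCat.of Λ K) j := by
    induction d with
    | zero =>
      intro j hj hjn K _ _ hK
      exact hX j hj (by lia) _
        (hM.lim_of_extVanishes hn fun i hi hin U hU ↦ hK i hi (by lia) U hU)
    | succ d ih =>
      intro j hj hjn K _ _ hK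
      obtain ⟨ι, U, π, hU, hπ⟩ := hM.exists_directSum_approximation K
      have hlim := hM.lim_directSum hU
      have h1 := ih (j + 1) (by lia) (by lia) (LinearMap.ker π) fun i hi hij V hV ↦
        hM.extVanishes_ker hlim hπ (by lia) hK hi hij hV
      exact .of_shortExact_right (shortExact_ker_subtype (hM.surjective_of_lift hπ))
        (hX j hj (by lia) _ hlim) h1
  obtain ⟨ι, U, π, hU, hπ⟩ := hM.exists_directSum_approximation X
  have h1 := key (n - 2) 1 one_pos (by lia) (LinearMap.ker π) fun i hi hij V hV ↦
    hM.extVanishes_ker (hM.lim_directSum hU) hπ (j := 0) (by lia) (by lia) hi hij hV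
  obtain ⟨g, hg⟩ := h1.exists_lift (shortExact_ker_subtype (hM.surjective_of_lift hπ)) (𝟙 X)
  exact ⟨ι, U, hU, ⟨⟨g, ModuleCat.ofHom π, hg⟩⟩⟩

end Approximation

/-! ### Pure submodules -/

section Pure

variable {Λ : Type u} [Ring Λ]

lemma isPureSubmodule_ker {X C : Type u} [AddCommGroup X] [Module Λ X] [AddCommGroup C]
    [Module Λ C] {π : X →ₗ[Λ] C}
    (h : ∀ (F : Type u) [AddCommGroup F] [Module Λ F] [Module.Finite Λ F] (f : F →ₗ[Λ] C),
      ∃ g : F →ₗ[Λ] X, π ∘ₗ g = f) : IsPureSubmodule (LinearMap.ker π) := by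
  intro F _ _ _ f
  obtain ⟨g, hg⟩ := h F ((LinearMap.ker π).liftQ π le_rfl ∘ₗ f)
  refine ⟨g, LinearMap.ext fun x ↦ ?_⟩
  obtain ⟨y, hy⟩ := (LinearMap.ker π).mkQ_surjective (f x)
  have h1 := congr($hg x)
  simp only [LinearMap.comp_apply, ← hy] at h1 ⊢
  rw [Submodule.mkQ_apply, Submodule.liftQ_apply] at h1
  rw [Submodule.mkQ_apply, Submodule.mkQ_apply, Submodule.Quotient.eq, LinearMap.mem_ker, map_sub,
    h1, sub_self]

/-- Purity is the solvability in `N` of finite systems of linear equations with constants in `N`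
which are solvable in `X`. -/
lemma isPureSubmodule_iff [IsNoetherianRing Λ] {X : Type u} [AddCommGroup X]
    [Module Λ X] {N : Submodule Λ X} :
    IsPureSubmodule N ↔ ∀ (k : ℕ) (K : Submodule Λ (Fin k → Λ)) (l : (Fin k → Λ) →ₗ[Λ] X),
      K.map l ≤ N → ∃ l' : (Fin k → Λ) →ₗ[Λ] X, K ≤ LinearMap.ker l' ∧ ∀ x, l x - l' x ∈ N := by
  constructor
  · intro h k K l hl
    have hle : K ≤ LinearMap.ker (N.mkQ ∘ₗ l) := fun x hx ↦
      (Submodule.Quotient.mk_eq_zero N).2 (hl ⟨x, hx, rfl⟩)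
    have := Module.finitePresentation_of_finite Λ ((Fin k → Λ) ⧸ K)
    obtain ⟨g, hg⟩ := h ((Fin k → Λ) ⧸ K) (K.liftQ (N.mkQ ∘ₗ l) hle)
    refine ⟨g ∘ₗ K.mkQ, fun x hx ↦ ?_, fun x ↦ ?_⟩
    · rw [LinearMap.mem_ker, LinearMap.comp_apply, Submodule.mkQ_apply,
        (Submodule.Quotient.mk_eq_zero K).2 hx, map_zero]
    · rw [← Submodule.Quotient.eq]
      exact congr($hg.symm (K.mkQ x))
  intro h F _ _ _ f
  obtain ⟨k, g, hg⟩ := Module.Finite.exists_fin' Λ F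
  obtain ⟨l, hl⟩ := Module.projective_lifting_property N.mkQ (f ∘ₗ g) N.mkQ_surjective
  have hker : (LinearMap.ker g).map l ≤ N := by
    rintro _ ⟨x, hx, rfl⟩
    have := congr($hl x)
    simp only [LinearMap.comp_apply, Submodule.mkQ_apply] at this
    rw [← Submodule.Quotient.mk_eq_zero, this, LinearMap.mem_ker.1 hx, map_zero]
  obtain ⟨l', hle, hlN⟩ := h k _ l hker
  refine ⟨(LinearMap.ker g).liftQ l' hle ∘ₗ (g.quotKerEquivOfSurjective hg).symm.toLinearMap, ?_⟩
  rw [← LinearMap.cancel_right hg]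
  refine LinearMap.ext fun x ↦ ?_
  have h1 : (g.quotKerEquivOfSurjective hg).symm (g x) = (LinearMap.ker g).mkQ x := by
    rw [LinearEquiv.symm_apply_eq]; simp
  have h2 := congr($hl x)
  simp only [LinearMap.comp_apply, LinearEquiv.coe_coe, h1] at h2 ⊢
  rw [Submodule.mkQ_apply, Submodule.mkQ_apply, Submodule.liftQ_apply, ← h2, Submodule.mkQ_apply,
    eq_comm, Submodule.Quotient.eq]
  exact hlN _

/-- Composing a solution in `X` with `σ` kills the constants, which span a finitely generated
submodule of `N`, and changes the solution only by elements of `N`. -/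
lemma isPureSubmodule_of_endomorphism [IsNoetherianRing Λ] {X : Type u} [AddCommGroup X]
    [Module Λ X] {N : Submodule Λ X} (h : ∀ L : Submodule Λ X, L ≤ N → L.FG →
      ∃ σ : X →ₗ[Λ] X, L ≤ LinearMap.ker σ ∧ ∀ x, x - σ x ∈ N) : IsPureSubmodule N := by
  refine isPureSubmodule_iff.2 fun k K l hl ↦ ?_
  obtain ⟨σ, hσ, hσN⟩ := h _ hl ((IsNoetherian.noetherian K).map l)
  exact ⟨σ ∘ₗ l, fun x hx ↦ hσ ⟨x, hx, rfl⟩, fun x ↦ hσN _⟩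

lemma isPureSubmodule_directSum_in_pi [IsNoetherianRing Λ] {ι : Type u} (X : ι → Type u)
    [∀ i, AddCommGroup (X i)] [∀ i, Module Λ (X i)] :
    IsPureSubmodule (LinearMap.range (DirectSum.coeFnLinearMap Λ (M := X))) := by
  classical
  refine isPureSubmodule_of_endomorphism fun L hL hfg ↦ ?_
  have hinj : Function.Injective (DirectSum.coeFnLinearMap Λ (M := X)) := DFunLike.coe_injective
  have : Module.Finite Λ L := Module.Finite.iff_fg.2 hfg
  obtain ⟨s, hs⟩ := exists_finset_factorization X
    ((LinearEquiv.ofInjective _ hinj).symm.toLinearMap ∘ₗ Submodule.inclusion hL)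
  -- The endomorphism erases the finitely many coordinates in which `L` is supported.
  refine ⟨LinearMap.pi fun i ↦ if i ∈ s then 0 else LinearMap.proj i, fun x hx ↦ ?_, fun x ↦ ?_⟩
  · rw [LinearMap.mem_ker]
    ext i
    simp only [LinearMap.pi_apply]
    split_ifs with hi
    · rfl
    · set y := ((LinearEquiv.ofInjective _ hinj).symm.toLinearMap ∘ₗ Submodule.inclusion hL) ⟨x, hx⟩
        with hy
      have h1 : DirectSum.coeFnLinearMap Λ y = x := by
        have := (LinearEquiv.ofInjective _ hinj).apply_symm_apply (Submodule.inclusion hL ⟨x, hx⟩)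
        exact congrArg Subtype.val this
      have h2 := hs ⟨x, hx⟩
      rw [← hy] at h2
      rw [LinearMap.proj_apply, ← h1]
      change y i = 0
      rw [← h2, DirectSum.sum_apply]
      exact Finset.sum_eq_zero fun j hj ↦ DirectSum.of_eq_of_ne j i _ fun h ↦ hi (h ▸ hj)
  · refine ⟨∑ i ∈ s, DirectSum.lof Λ ι X i (x i), ?_⟩
    ext i
    rw [map_sum, Finset.sum_apply]
    by_cases hi : i ∈ s
    · rw [Finset.sum_eq_single_of_mem i hi]
      · simp [hi, DirectSum.lof_eq_of]
      · intro j _ hj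
        exact DirectSum.of_eq_of_ne _ _ _ hj.symm
    · rw [Finset.sum_eq_zero]
      · simp [hi]
      · exact fun j hj ↦ DirectSum.of_eq_of_ne j i _ fun h ↦ hi (h ▸ hj)

lemma exists_retraction_of_isCompl {X N : Type*} [AddCommGroup X] [Module Λ X] [AddCommGroup N]
    [Module Λ N] {f : N →ₗ[Λ] X} (hf : Function.Injective f)
    (h : ∃ N' : Submodule Λ X, IsCompl (LinearMap.range f) N') :
    ∃ r : X →ₗ[Λ] N, r ∘ₗ f = LinearMap.id := by
  obtain ⟨N', hN'⟩ := h
  refine ⟨(LinearEquiv.ofInjective f hf).symm.toLinearMap ∘ₗ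
    Submodule.projectionOnto _ _ hN', LinearMap.ext fun x ↦ ?_⟩
  have : f x = ((LinearEquiv.ofInjective f hf x : LinearMap.range f) : X) := rfl
  simp only [LinearMap.comp_apply, LinearEquiv.coe_coe, LinearMap.id_apply]
  rw [this, Submodule.projectionOnto_apply_left, LinearEquiv.symm_apply_apply]

end Pure

/-! ### Purity and cluster tilting -/

section Equivalences

variable {Λ : Type u} [Ring Λ] [IsNoetherianRing Λ] {M : ObjectProperty (FGModuleCat.{u} Λ)}
variable {n : ℕ} (hM : IsNClusterTilting n M)

include hM

lemma IsNClusterTilting.isNRigid_of_lim_le_add (h : lim M ≤ Add M) : IsNRigid n (lim M) :=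
  fun _ hk hkn _ _ hX hY ↦ hM.extVanishes_add (h _ hX) hY hk hkn

lemma IsNClusterTilting.limIsPureSemisimple_of_ext
    (h : ∀ X Y : ModuleCat.{u} Λ, lim M X → lim M Y → ExtVanishes X Y 1) :
    LimIsPureSemisimple M := by
  intro S h₁ h₂ h₃ hS
  -- As Λ lies in `M`, testing on Λ shows that pure-exact sequences are short exact.
  obtain ⟨hinj, hex, hsurj⟩ := hS (FGModuleCat.of Λ Λ) hM.mem_self
  have aux (X : ModuleCat.{u} Λ) (x : X) : ∃ f : ModuleCat.of Λ Λ ⟶ X, f.hom 1 = x :=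
    ⟨ModuleCat.ofHom (LinearMap.toSpanSingleton Λ X x), by simp⟩
  have hsh : S.ShortExact := by
    refine ModuleCat.shortComplex_shortExact _ ?_ ?_ ?_
    · intro b
      constructor
      · intro hb
        obtain ⟨φ, rfl⟩ := aux _ b
        obtain ⟨a, ha⟩ := hex φ (ModuleCat.hom_ext (LinearMap.ext_ring hb))
        exact ⟨a.hom (1 : Λ), by simpa using congr(($ha).hom (1 : Λ))⟩
      · rintro ⟨a, rfl⟩
        exact S.moduleCat_zero_apply a
    · intro a b hab
      obtain ⟨φ, rfl⟩ := aux _ a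
      obtain ⟨ψ, rfl⟩ := aux _ b
      have : φ = ψ := hinj (ModuleCat.hom_ext (LinearMap.ext_ring hab))
      rw [this]
    · intro c
      obtain ⟨φ, rfl⟩ := aux _ c
      obtain ⟨b, hb⟩ := hsurj φ
      exact ⟨b.hom (1 : Λ), by simpa using congr(($hb).hom (1 : Λ))⟩
  obtain ⟨s, hs⟩ := (h _ _ h₃ h₁).exists_lift hsh (𝟙 S.X₃)
  have := hsh.mono_f
  exact ⟨ShortComplex.Splitting.ofExactOfSection S hsh.exact s hs this⟩

lemma IsNClusterTilting.exists_isCompl_of_limIsPureSemisimple (h : LimIsPureSemisimple M)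
    (X : ModuleCat.{u} Λ) (hX : Add M X) (N : Submodule Λ X) (hN : IsPureSubmodule N) :
    ∃ N' : Submodule Λ X, IsCompl N N' := by
  have hX' : lim M X := hM.add_le_lim _ hX
  have hS := shortExact_subtype_mkQ N
  obtain ⟨s⟩ := h (ShortComplex.mk (ModuleCat.ofHom N.subtype) (ModuleCat.ofHom N.mkQ)
      (ModuleCat.hom_ext (LinearMap.exact_subtype_mkQ N).linearMap_comp_eq_zero))
    (hM.lim_of_isPureSubmodule hX' hN) hX' (hX'.quotient hN) (by
    intro U hU
    refine ⟨fun a b hab ↦ ?_, fun b hb ↦ ?_, fun c ↦ ?_⟩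
    · have : Mono (ModuleCat.ofHom N.subtype) := hS.mono_f
      exact (cancel_mono (ModuleCat.ofHom N.subtype)).1 hab
    · have := hS.mono_f
      exact ⟨hS.exact.lift b hb, hS.exact.lift_f b hb⟩
    · have : Module.Finite Λ U.obj := U.property
      have := Module.finitePresentation_of_finite Λ U.obj
      obtain ⟨g, hg⟩ := hN U.obj c.hom
      exact ⟨ModuleCat.ofHom g, ModuleCat.hom_ext hg⟩)
  exact ⟨LinearMap.ker s.r.hom, LinearMap.isCompl_of_proj fun x ↦ congr(($(s.f_r)).hom x)⟩

/-- Morphisms from finitely generated modules to `C` factor through `M`, hence lift along the right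
approximation by a direct sum. So its kernel is pure, and a complement splits the approximation. -/
lemma IsNClusterTilting.lim_le_add_of_exists_isCompl
    (h : ∀ X : ModuleCat.{u} Λ, Add M X → ∀ N : Submodule Λ X,
        IsPureSubmodule N → ∃ N' : Submodule Λ X, IsCompl N N') : lim M ≤ Add M := by
  intro C hC
  obtain ⟨ι, U, π, hU, hπ⟩ := hM.exists_directSum_approximation C
  have hpure : IsPureSubmodule (LinearMap.ker π) := isPureSubmodule_ker fun F _ _ _ f ↦ by
    obtain ⟨V, a, b, hV, rfl⟩ := lim.exists_factorization (C := C) hC f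
    obtain ⟨g, rfl⟩ := hπ V hV b
    exact ⟨g ∘ₗ a, rfl⟩
  obtain ⟨N', hN'⟩ := h (ModuleCat.of Λ (DirectSum ι fun i ↦ (U i).obj))
    ⟨ι, U, hU, ⟨Retract.refl _⟩⟩ _ hpure
  have hs := hM.surjective_of_lift hπ
  refine ⟨ι, U, hU, ⟨⟨ModuleCat.ofHom (N'.subtype ∘ₗ
    (Submodule.quotientEquivOfIsCompl _ _ hN').toLinearMap ∘ₗ
      (π.quotKerEquivOfSurjective hs).symm.toLinearMap), ModuleCat.ofHom π, ?_⟩⟩⟩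
  apply ModuleCat.hom_ext
  rw [ModuleCat.hom_comp, ModuleCat.hom_ofHom, ModuleCat.hom_ofHom, ← LinearMap.cancel_right hs]
  refine LinearMap.ext fun x ↦ ?_
  have h1 : (π.quotKerEquivOfSurjective hs).symm (π x) = (LinearMap.ker π).mkQ x := by
    rw [LinearEquiv.symm_apply_eq]; simp
  simp only [LinearMap.comp_apply, LinearEquiv.coe_coe, h1, ModuleCat.hom_id, LinearMap.id_apply]
  set y := Submodule.quotientEquivOfIsCompl _ _ hN' ((LinearMap.ker π).mkQ x) with hy
  have h2 : (Submodule.quotientEquivOfIsCompl _ _ hN').symm y = (LinearMap.ker π).mkQ x := by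
    rw [hy, LinearEquiv.symm_apply_apply]
  rw [Submodule.quotientEquivOfIsCompl_symm_apply, Submodule.mkQ_apply, Submodule.Quotient.eq,
    LinearMap.mem_ker, map_sub, sub_eq_zero] at h2
  exact h2

lemma IsNClusterTilting.lim_isNClusterTilting (hn : 2 ≤ n) (hrigid : IsNRigid n (lim M))
    (hpure : ∀ X : ModuleCat.{u} Λ, Add M X → ∀ N : Submodule Λ X,
        IsPureSubmodule N → ∃ N' : Submodule Λ X, IsCompl N N') :
    IsNClusterTilting n (lim M) where
  generating A := by
    obtain ⟨ι, U, π, hU, hπ⟩ := hM.exists_directSum_approximation A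
    exact ⟨_, ModuleCat.ofHom π, hM.lim_directSum hU,
      (ModuleCat.epi_iff_surjective _).2 (hM.surjective_of_lift hπ)⟩
  cogenerating A := ⟨Injective.under A, Injective.ι A,
    hM.lim_of_extVanishes hn fun _ hi _ _ _ ↦ extVanishes_of_injective _ _ _ hi, inferInstance⟩
  functoriallyFinite := by
    classical
    have hadd := hM.lim_le_add_of_exists_isCompl hpure
    refine ⟨fun A ↦ ?_, fun A ↦ ?_⟩
    · obtain ⟨ι, U, π, hU, hπ⟩ := hM.exists_directSum_approximation A
      refine ⟨_, ModuleCat.ofHom π, hM.lim_directSum hU, fun C f hC ↦ ?_⟩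
      obtain ⟨κ, V, hV, ⟨r⟩⟩ := hadd _ hC
      have h j := hπ (V j) (hV j) (f.hom ∘ₗ r.r.hom ∘ₗ DirectSum.lof Λ κ (fun j ↦ (V j).obj) j)
      choose g hg using h
      refine ⟨r.i ≫ ModuleCat.ofHom (DirectSum.toModule Λ κ _ g), ?_⟩
      have h2 : ModuleCat.ofHom (DirectSum.toModule Λ κ _ g) ≫ ModuleCat.ofHom π = r.r ≫ f := by
        apply ModuleCat.hom_ext
        refine DirectSum.linearMap_ext _ fun j ↦ ?_
        ext x
        have := congr($(hg j) x)
        simp only [LinearMap.comp_apply] at this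
        simp [this]
      rw [Category.assoc, h2, r.retract_assoc]
    · obtain ⟨ι, U, θ, hU, hθ⟩ := hM.exists_pi_approximation A
      refine ⟨_, ModuleCat.ofHom θ, hM.lim_pi fun i ↦ lim_of_mem (hU i), fun C f hC ↦ ?_⟩
      obtain ⟨κ, V, hV, ⟨r⟩⟩ := hadd _ hC
      -- The product of the `V j` lies in `lim M`, hence in `Add M`, so its pure submodule, the
      -- direct sum, is a summand. Maps to the direct sum can be factored through `θ` coordinatewise
      -- in the product and then retracted.
      obtain ⟨ρ, hρ⟩ := exists_retraction_of_isCompl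
        (f := DirectSum.coeFnLinearMap Λ (M := fun j ↦ ((V j).obj : Type u)))
        DFunLike.coe_injective
        (hpure (ModuleCat.of Λ (∀ j, (V j).obj)) (hadd _ (hM.lim_pi fun j ↦ lim_of_mem (hV j))) _
          (isPureSubmodule_directSum_in_pi _))
      have h j := hθ (V j) (hV j) (LinearMap.proj j ∘ₗ
        DirectSum.coeFnLinearMap Λ (M := fun j ↦ ((V j).obj : Type u)) ∘ₗ r.i.hom ∘ₗ f.hom)
      choose g hg using h
      refine ⟨ModuleCat.ofHom (ρ ∘ₗ LinearMap.pi g) ≫ r.r, ?_⟩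
      have h2 : ModuleCat.ofHom θ ≫ ModuleCat.ofHom (ρ ∘ₗ LinearMap.pi g) = f ≫ r.i := by
        apply ModuleCat.hom_ext
        refine LinearMap.ext fun x ↦ ?_
        have h3 : LinearMap.pi g (θ x) = DirectSum.coeFnLinearMap Λ (r.i.hom (f.hom x)) :=
          funext fun j ↦ congr($(hg j) x)
        have h4 := congr($hρ (r.i.hom (f.hom x)))
        simp only [LinearMap.comp_apply] at h4
        rw [← h3] at h4
        exact h4
      rw [← Category.assoc, h2, Category.assoc, r.retract, Category.comp_id]
  rightPerp_eq := le_antisymm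
    (fun Y hY ↦ hM.lim_of_extVanishes hn fun i hi hin U hU ↦ hY i hi hin _ (lim_of_mem hU))
    (fun Y hY i hi hin X hX ↦ hrigid i hi hin X Y hX hY)
  leftPerp_eq := le_antisymm
    (fun X hX ↦ hM.add_le_lim _ (hM.add_of_extVanishes hn hX))
    (fun X hX i hi hin Y hY ↦ hrigid i hi hin X Y hX hY)

end Equivalences

/-! ### Duality over a commutative artinian ring -/

section Duality

variable {R : Type u} [CommRing R]

/-- Injective hulls inside an injective module. -/
lemma exists_injective_essential {Q : Type u} [AddCommGroup Q] [Module R Q]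
    [hQ : Module.Injective R Q] (T : Submodule R Q) :
    ∃ E : Submodule R Q, T ≤ E ∧ Module.Injective R E ∧
      ∀ x ∈ E, x ≠ 0 → ∃ r : R, r • x ∈ T ∧ r • x ≠ 0 := by
  -- `E` is a maximal essential extension of `T` in `Q`, and `C` below is maximal with `C ∩ E = 0`.
  -- Injectivity of `Q` gives `p`, the identity on `E` and zero on `C`; it is shown to be a
  -- projection onto `E`.
  obtain ⟨E, hTE, hE⟩ := zorn_le_nonempty₀
    {E : Submodule R Q | ∀ x ∈ E, x ≠ 0 → ∃ r : R, r • x ∈ T ∧ r • x ≠ 0}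
    (fun c hc hchain y hy ↦ ⟨sSup c, fun x hx hx0 ↦ by
      rw [Submodule.mem_sSup_of_directed ⟨y, hy⟩ hchain.directedOn] at hx
      obtain ⟨E, hE, hxE⟩ := hx
      exact hc hE x hxE hx0, fun z hz ↦ le_sSup hz⟩)
    T (fun x hx hx0 ↦ ⟨1, by simpa using hx, by simpa using hx0⟩)
  obtain ⟨C, -, hC⟩ := zorn_le_nonempty₀ {C : Submodule R Q | ∀ x ∈ C, x ∈ E → x = 0}
    (fun c hc hchain y hy ↦ ⟨sSup c, fun x hx hxE ↦ by
      rw [Submodule.mem_sSup_of_directed ⟨y, hy⟩ hchain.directedOn] at hx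
      obtain ⟨C, hC, hxC⟩ := hx
      exact hc hC x hxC hxE, fun z hz ↦ le_sSup hz⟩)
    ⊥ (fun x hx _ ↦ by simpa using hx)
  have hCE := hC.prop
  have hinj : Function.Injective (C.mkQ ∘ₗ E.subtype) := by
    rw [← LinearMap.ker_eq_bot, LinearMap.ker_eq_bot']
    intro x hx
    have : (x : Q) ∈ C := by simpa using hx
    exact Subtype.ext (hCE x this x.2)
  obtain ⟨h, hh⟩ := hQ.out (C.mkQ ∘ₗ E.subtype) hinj E.subtype
  let p : Q →ₗ[R] Q := h ∘ₗ C.mkQ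
  have hp (x : Q) (hx : x ∈ E) : p x = x := hh ⟨x, hx⟩
  have hker (x : Q) (hx : p x = 0) : x ∈ C := by
    have : LinearMap.ker p ≤ C := hC.le_of_ge (y := LinearMap.ker p)
      (fun y hy hyE ↦ by rw [← hp y hyE]; exact hy)
      (fun y hy ↦ by
        have : C.mkQ y = 0 := by simpa using hy
        simp only [p, LinearMap.mem_ker, LinearMap.comp_apply, this, map_zero])
    exact this hx
  -- The image of `p` is again essential over `T`: by maximality of `C`, if `q ∉ C` then some
  -- nonzero `c + r • q` lies in `E`, and it equals `r • p q`.
  have hrange : LinearMap.range p ≤ E := by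
    refine hE.le_of_ge (y := LinearMap.range p) ?_ (fun x hx ↦ ⟨x, hp x hx⟩)
    rintro _ ⟨q, rfl⟩ hq
    have hqC : q ∉ C := fun hqC ↦ hq (by
      have : C.mkQ q = 0 := by simpa using hqC
      simp only [p, LinearMap.comp_apply, this, map_zero])
    have hnot : ¬ ∀ x ∈ C ⊔ Submodule.span R {q}, x ∈ E → x = 0 := fun hall ↦
      hqC (hC.le_of_ge (y := C ⊔ Submodule.span R {q}) hall le_sup_left
        (Submodule.mem_sup_right (Submodule.mem_span_singleton_self q)))
    push Not at hnot
    obtain ⟨x, hx, hxE, hx0⟩ := hnot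
    obtain ⟨c, hc, _, hy, rfl⟩ := Submodule.mem_sup.1 hx
    obtain ⟨r, rfl⟩ := Submodule.mem_span_singleton.1 hy
    have hc0 : C.mkQ c = 0 := by simpa using hc
    have h1 : r • p q = c + r • q := by
      rw [← hp _ hxE, map_add, map_smul]
      have : p c = 0 := by simp only [p, LinearMap.comp_apply, hc0, map_zero]
      rw [this, zero_add]
    obtain ⟨s, hs, hs0⟩ := hE.prop _ hxE hx0
    exact ⟨s * r, by rwa [mul_smul, h1], by rwa [mul_smul, h1]⟩
  refine ⟨E, hTE, ⟨fun X Y _ _ _ _ f hf g ↦ ?_⟩, hE.prop⟩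
  obtain ⟨k, hk⟩ := hQ.out f hf (E.subtype ∘ₗ g)
  refine ⟨p.codRestrict E (fun x ↦ hrange ⟨x, rfl⟩) ∘ₗ k, fun x ↦ Subtype.ext ?_⟩
  simp only [LinearMap.comp_apply, LinearMap.codRestrict_apply, hk]
  exact hp _ (g x).2

variable (R) in
/-- An artinian commutative ring has an injective module `J` such that `Hom(S, J)` has length one
for every simple module `S`. -/
lemma exists_injective_length_le_one [IsArtinianRing R] :
    ∃ (J : Type u) (_ : AddCommGroup J) (_ : Module R J), Module.Injective R J ∧
      ∀ m : Ideal R, m.IsMaximal →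
        Module.length R ((R ⧸ m) →ₗ[R] J) ≤ 1 ∧ ∃ f : (R ⧸ m) →ₗ[R] J, f ≠ 0 := by
  classical
  let T : Type u := ∀ m : MaximalSpectrum R, R ⧸ m.asIdeal
  let Q := Injective.under (ModuleCat.of R T)
  let j : T →ₗ[R] Q := (Injective.ι (ModuleCat.of R T)).hom
  have hj : Function.Injective j := (ModuleCat.mono_iff_injective _).1 inferInstance
  have hQ : Module.Injective R Q := Module.injective_module_of_injective_object (inj := inferInstanceAs (Injective Q))
  obtain ⟨E, hTE, hE, hess⟩ := exists_injective_essential (LinearMap.range j)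
  refine ⟨E, inferInstance, inferInstance, hE, fun m hm ↦ ⟨?_, ?_⟩⟩
  · let K : Submodule R Q := LinearMap.range
      (j ∘ₗ LinearMap.single R (fun m : MaximalSpectrum R ↦ R ⧸ m.asIdeal) ⟨m, hm⟩)
    let ev : ((R ⧸ m) →ₗ[R] E) →ₗ[R] Q := E.subtype ∘ₗ LinearMap.applyₗ 1
    have hzero (f : (R ⧸ m) →ₗ[R] E) (a : R) (ha : a ∈ m) : a • f 1 = 0 := by
      rw [← map_smul, Algebra.smul_def, mul_one, Ideal.Quotient.algebraMap_eq,
        Ideal.Quotient.eq_zero_iff_mem.2 ha, map_zero]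
    -- The value `f 1` is killed by `m`. Essentiality gives a multiple of it in `T` by some `r ∉ m`,
    -- invertible modulo `m`, so `f 1` itself comes from `T`; its coordinates at other maximal
    -- ideals vanish. Hence Hom(R/m, E) embeds in a quotient of R/m.
    have hev (f : (R ⧸ m) →ₗ[R] E) : ev f ∈ K := by
      by_cases hf : ev f = 0
      · exact hf ▸ K.zero_mem
      obtain ⟨r, ⟨t, ht⟩, hr0⟩ := hess _ (f 1).2 hf
      have hrm : r ∉ m := fun h ↦ hr0 congr(($(hzero f r h) : Q))
      obtain ⟨s, a, ha, hs⟩ := hm.exists_inv hrm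
      have hx : j (s • t) = ev f := by
        rw [map_smul, ht, smul_smul]
        have h1 : ((s * r + a) • f 1 : E) = f 1 := by rw [hs, one_smul]
        rw [add_smul, hzero f a ha, add_zero] at h1
        exact congr(($h1 : Q))
      refine ⟨(s • t) ⟨m, hm⟩, ?_⟩
      rw [← hx]
      refine congrArg j (funext fun m' ↦ ?_)
      rw [LinearMap.single_apply]
      by_cases hmm : m' = ⟨m, hm⟩
      · subst hmm; simp
      rw [Pi.single_eq_of_ne hmm]
      obtain ⟨a, ham, ham'⟩ := Set.not_subset.1 fun hle : (m : Set R) ⊆ m'.asIdeal ↦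
        hmm (MaximalSpectrum.ext (hm.eq_of_le m'.isMaximal.ne_top hle).symm)
      have h1 : a • (s • t) = 0 := hj (by
        rw [map_smul, hx, map_zero]; exact congr(($(hzero f a ham) : Q)))
      have h2 := congrFun h1 m'
      rw [Pi.smul_apply, Algebra.smul_def, Ideal.Quotient.algebraMap_eq] at h2
      have := m'.isMaximal
      have := Ideal.Quotient.isDomain m'.asIdeal
      exact ((mul_eq_zero.1 h2).resolve_left fun h ↦ ham' (Ideal.Quotient.eq_zero_iff_mem.1 h)).symm
    have hinj : Function.Injective (ev.codRestrict K hev) := by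
      intro f g hfg
      have h1 : f 1 = g 1 := Subtype.ext congr(($hfg : Q))
      ext
      simp [h1]
    have : IsSimpleModule R (R ⧸ m) := isSimpleModule_iff_isCoatom.2 hm.out
    calc Module.length R ((R ⧸ m) →ₗ[R] E) ≤ Module.length R K :=
          Module.length_le_of_injective _ hinj
      _ ≤ Module.length R (R ⧸ m) :=
          Module.length_le_of_surjective _ (LinearMap.surjective_rangeRestrict _)
      _ = 1 := Module.length_eq_one R _
  · let i : (R ⧸ m) →ₗ[R] T := LinearMap.single R (fun m : MaximalSpectrum R ↦ R ⧸ m.asIdeal) ⟨m, hm⟩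
    refine ⟨(j ∘ₗ i).codRestrict E fun x ↦ hTE ⟨_, rfl⟩, fun h ↦ ?_⟩
    have h1 : j (i 1) = 0 := congr(($h 1 : Q))
    have h2 : i 1 = 0 := hj (by rw [h1, map_zero])
    have h3 : (1 : R ⧸ m) = 0 :=
      (Pi.single_eq_same (M := fun m : MaximalSpectrum R ↦ R ⧸ m.asIdeal) ⟨m, hm⟩ 1).symm.trans
        (congrFun h2 ⟨m, hm⟩)
    exact hm.ne_top ((Ideal.Quotient.subsingleton_iff).1 (subsingleton_of_zero_eq_one h3.symm))

variable {J : Type u} [AddCommGroup J] [Module R J]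

lemma length_dual_le (hJ : ∀ m : Ideal R, m.IsMaximal → Module.length R ((R ⧸ m) →ₗ[R] J) ≤ 1)
    {Y : Type u} [AddCommGroup Y] [Module R Y] (hY : IsFiniteLength R Y) :
    Module.length R (Y →ₗ[R] J) ≤ Module.length R Y := by
  induction hY with
  | of_subsingleton =>
    rw [Module.length_eq_zero]
    exact zero_le
  | @of_simple_quotient Y _ _ N hN _ ih =>
    obtain ⟨m, hm, ⟨e⟩⟩ := isSimpleModule_iff_quot_maximal.1 hN
    have h1 : Module.length R (Y →ₗ[R] J) ≤
        Module.length R ((Y ⧸ N) →ₗ[R] J) + Module.length R (N →ₗ[R] J) := by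
      let g : (Y →ₗ[R] J) →ₗ[R] (N →ₗ[R] J) := LinearMap.lcomp R J N.subtype
      let f : ((Y ⧸ N) →ₗ[R] J) →ₗ[R] (Y →ₗ[R] J) := LinearMap.lcomp R J N.mkQ
      have hf : Function.Injective f := fun a b hab ↦
        LinearMap.ext fun x ↦ by
          obtain ⟨x, rfl⟩ := N.mkQ_surjective x
          exact congr($hab x)
      have hex : Function.Exact f g.rangeRestrict := fun a ↦ by
        constructor
        · intro ha
          have h0 : g a = 0 := congr(($ha : N →ₗ[R] J))
          exact ⟨N.liftQ a fun x hx ↦ congr($h0 ⟨x, hx⟩), LinearMap.ext fun x ↦ rfl⟩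
        · rintro ⟨b, rfl⟩
          refine Subtype.ext (LinearMap.ext fun x ↦ ?_)
          change b (N.mkQ x) = 0
          rw [Submodule.mkQ_apply, (Submodule.Quotient.mk_eq_zero N).2 x.2, map_zero]
      rw [Module.length_eq_add_of_exact f g.rangeRestrict hf g.surjective_rangeRestrict hex]
      gcongr
      exact Module.length_le_of_injective _ (Submodule.subtype_injective _)
    rw [Module.length_eq_add_of_exact N.subtype N.mkQ N.subtype_injective N.mkQ_surjective
      (LinearMap.exact_subtype_mkQ N), add_comm, Module.length_eq_one R (Y ⧸ N)]
    refine h1.trans ?_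
    gcongr
    rw [(LinearEquiv.congrLeft J R e).length_eq]
    exact hJ m hm

/-- The module `J` separates the elements of all modules. -/
lemma exists_linearMap_ne_zero [Module.Injective R J]
    (hJ : ∀ m : Ideal R, m.IsMaximal → ∃ f : (R ⧸ m) →ₗ[R] J, f ≠ 0)
    {Y : Type u} [AddCommGroup Y] [Module R Y] {W : Submodule R Y} {y : Y} (hy : y ∉ W) :
    ∃ φ : Y →ₗ[R] J, (∀ w ∈ W, φ w = 0) ∧ φ y ≠ 0 := by
  let t : R →ₗ[R] Y ⧸ W := LinearMap.toSpanSingleton R _ (W.mkQ y)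
  have ht : LinearMap.ker t ≠ ⊤ := fun h ↦ hy (by
    have : (1 : R) ∈ LinearMap.ker t := h ▸ Submodule.mem_top
    simpa [t] using this)
  obtain ⟨m, hm, hle⟩ := Ideal.exists_le_maximal _ ht
  obtain ⟨f, hf⟩ := hJ m hm
  obtain ⟨h, hh⟩ := Module.Injective.out (Q := J) ((LinearMap.ker t).liftQ t le_rfl)
    (LinearMap.ker_eq_bot.1 (Submodule.ker_liftQ_eq_bot _ _ _ le_rfl))
    (f ∘ₗ Submodule.mapQ _ m LinearMap.id hle)
  refine ⟨h ∘ₗ W.mkQ, fun w hw ↦ ?_, fun h0 ↦ hf ?_⟩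
  · have : W.mkQ w = 0 := by simpa using hw
    rw [LinearMap.comp_apply, this, map_zero]
  have h1 := hh ((LinearMap.ker t).mkQ 1)
  have h2 : (LinearMap.ker t).liftQ t le_rfl ((LinearMap.ker t).mkQ 1) = W.mkQ y := one_smul R (W.mkQ y)
  rw [h2] at h1
  have h3 : f ((1 : R) : R ⧸ m) = 0 := h1.symm.trans h0
  ext
  simpa using h3

variable [IsArtinianRing R]

lemma finite_dual (hJ : ∀ m : Ideal R, m.IsMaximal → Module.length R ((R ⧸ m) →ₗ[R] J) ≤ 1)
    (Y : Type u) [AddCommGroup Y] [Module R Y] [Module.Finite R Y] :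
    Module.Finite R (Y →ₗ[R] J) := by
  have hY : IsFiniteLength R Y := isFiniteLength_iff_isNoetherian_isArtinian.2
    ⟨inferInstance, inferInstance⟩
  have : IsFiniteLength R (Y →ₗ[R] J) := Module.length_ne_top_iff.1
    (ne_top_of_le_ne_top (Module.length_ne_top_iff.2 hY) (length_dual_le hJ hY))
  have := (isFiniteLength_iff_isNoetherian_isArtinian.1 this).1
  infer_instance

/-- Dualizing does not increase length, so the bidual is no longer than `Y`; evaluation into it is
injective because `J` separates elements, hence bijective. -/
lemma exists_eq_eval [Module.Injective R J]
    (hJ : ∀ m : Ideal R, m.IsMaximal →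
      Module.length R ((R ⧸ m) →ₗ[R] J) ≤ 1 ∧ ∃ f : (R ⧸ m) →ₗ[R] J, f ≠ 0)
    {Y : Type u} [AddCommGroup Y] [Module R Y] [Module.Finite R Y] (β : (Y →ₗ[R] J) →ₗ[R] J) :
    ∃ y : Y, ∀ φ, β φ = φ y := by
  have hfl (Z : Type u) [AddCommGroup Z] [Module R Z] [Module.Finite R Z] : IsFiniteLength R Z :=
    isFiniteLength_iff_isNoetherian_isArtinian.2 ⟨inferInstance, inferInstance⟩
  have := finite_dual (fun m hm ↦ (hJ m hm).1) Y
  have hle := (length_dual_le (fun m hm ↦ (hJ m hm).1) (hfl (Y →ₗ[R] J))).trans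
    (length_dual_le (fun m hm ↦ (hJ m hm).1) (hfl Y))
  let ev : Y →ₗ[R] (Y →ₗ[R] J) →ₗ[R] J := LinearMap.applyₗ
  have hinj : Function.Injective ev := by
    rw [← LinearMap.ker_eq_bot, LinearMap.ker_eq_bot']
    intro y hy
    by_contra hy0
    obtain ⟨φ, -, hφ⟩ := exists_linearMap_ne_zero (fun m hm ↦ (hJ m hm).2)
      (W := ⊥) (y := y) (by simpa using hy0)
    exact hφ congr($hy φ)
  have hrange : LinearMap.range ev = ⊤ := by
    by_contra h
    have := finite_dual (fun m hm ↦ (hJ m hm).1) (Y →ₗ[R] J)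
    exact (Submodule.length_lt h).not_ge
      (hle.trans_eq (LinearEquiv.ofInjective ev hinj).length_eq)
  obtain ⟨y, rfl⟩ : β ∈ LinearMap.range ev := hrange ▸ Submodule.mem_top
  exact ⟨y, fun φ ↦ rfl⟩

end Duality

/-! ### Endomorphism rings and split monomorphisms -/

section Isolation

variable {R : Type u} [CommRing R] {Λ : Type u} [Ring Λ] [Algebra R Λ]

lemma isUnit_comp_of_split {X Y : Type u} [AddCommGroup X] [Module Λ X] [AddCommGroup Y]
    [Module Λ Y] {f : X →ₗ[Λ] Y} {g : Y →ₗ[Λ] X} (h : IsUnit (M := Module.End Λ X) (g ∘ₗ f)) :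
    ∃ g' : Y →ₗ[Λ] X, g' ∘ₗ f = LinearMap.id := by
  obtain ⟨u, hu⟩ := h
  refine ⟨(↑u⁻¹ : Module.End Λ X) ∘ₗ g, ?_⟩
  rw [LinearMap.comp_assoc, ← hu]
  exact u.inv_mul

variable (R Λ) in
lemma finite_end [IsNoetherianRing R] [Module.Finite R Λ] (X : Type u) [AddCommGroup X]
    [Module Λ X] [Module.Finite Λ X] [Module R X] [IsScalarTower R Λ X] :
    Module.Finite R (Module.End Λ X) := by
  have : Module.Finite R X := Module.Finite.trans Λ X
  obtain ⟨m, s, hs⟩ := Module.Finite.exists_fin (R := Λ) (M := X)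
  let ψ : Module.End Λ X →ₗ[R] (Fin m → X) :=
    { toFun g i := g (s i), map_add' _ _ := rfl, map_smul' _ _ := rfl }
  exact Module.Finite.of_injective ψ fun g h hgh ↦ LinearMap.ext_on_range hs fun i ↦ congrFun hgh i

/-- For a module `X` with local endomorphism ring over an artin algebra, the morphisms `f` starting
at `X` which are not split monomorphisms are detected by the solvability of a single finite system
of linear equations, with right-hand sides in `f(X)`. -/
lemma exists_linear_system [IsArtinianRing R] [Module.Finite R Λ] (X : Type u) [AddCommGroup X]
    [Module Λ X] [Module.Finite Λ X] [Module R X] [IsScalarTower R Λ X]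
    [IsLocalRing (Module.End Λ X)] :
    ∃ (k l : ℕ) (x : Fin k → X) (a : Fin l → Fin k → Λ),
      (¬ ∃ z : Fin l → X, ∀ i, x i = ∑ j, a j i • z j) ∧
      ∀ (Y : Type u) [AddCommGroup Y] [Module Λ Y] [Module R Y] [IsScalarTower R Λ Y]
        (f : X →ₗ[Λ] Y),
        (∀ g : Y →ₗ[Λ] X, g ∘ₗ f ≠ LinearMap.id) →
          ∃ z : Fin l → Y, ∀ i, f (x i) = ∑ j, a j i • z j := by
  classical
  -- Write D for Hom_R(-, J). A nonzero functional on End(X) vanishing on nonunits corresponds to an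
  -- element Σ ε i ⊗ x i of DX ⊗_Λ X, and the linear system expresses that Σ ε i ⊗ f (x i) vanishes
  -- in DX ⊗_Λ Y.
  obtain ⟨J, _, _, _, hJ⟩ := exists_injective_length_le_one R
  have : Module.Finite R X := Module.Finite.trans Λ X
  have := finite_end R Λ X
  have hDfin := finite_dual (fun m hm ↦ (hJ m hm).1) X
  obtain ⟨k, ε, hε⟩ := Module.Finite.exists_fin (R := R) (M := X →ₗ[R] J)
  -- a functional on the endomorphism ring vanishing on the nonunits
  let W₀ : Submodule R (Module.End Λ X) :=
    { carrier := nonunits _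
      add_mem' := IsLocalRing.nonunits_add
      zero_mem' := zero_mem_nonunits.2 zero_ne_one
      smul_mem' r g hg hu := hg (by
        rw [← smul_one_mul] at hu
        exact ((((Commute.one_left g).smul_left r).isUnit_mul_iff).1 hu).2) }
  obtain ⟨α, hα, hα1⟩ := exists_linearMap_ne_zero (fun m hm ↦ (hJ m hm).2) (W := W₀) (y := 1)
    (fun h ↦ h isUnit_one)
  -- it is given by finitely many elements of `X`
  obtain ⟨x, hx⟩ : ∃ x : Fin k → X, ∀ g, α g = ∑ i, ε i (g (x i)) := by
    let Φ : (Fin k → X) →ₗ[R] (Module.End Λ X →ₗ[R] J) :=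
      { toFun x :=
          { toFun g := ∑ i, ε i (g (x i))
            map_add' g h := by simp [Finset.sum_add_distrib]
            map_smul' r g := by simp [Finset.smul_sum] }
        map_add' x y := by ext g; simp [Finset.sum_add_distrib]
        map_smul' r x := by
          ext g
          simp [Finset.smul_sum, LinearMap.map_smul_of_tower] }
    -- If `α` were not in the image of `Φ`, a functional separating it would be evaluation at some
    -- endomorphism `g` by reflexivity. But all `ε i` vanish on the image of `g`, so `g = 0`.
    by_contra! h
    obtain ⟨γ, hγ, hγα⟩ := exists_linearMap_ne_zero (fun m hm ↦ (hJ m hm).2)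
      (W := LinearMap.range Φ) (y := α) (fun ⟨x, hx⟩ ↦ by
        obtain ⟨g, hg⟩ := h x
        exact hg congr($hx.symm g))
    obtain ⟨g, hg⟩ := exists_eq_eval hJ γ
    have h1 (φ : X →ₗ[R] J) (z : X) : φ (g z) = 0 := by
      have : φ ∈ Submodule.span R (Set.range ε) := hε ▸ Submodule.mem_top
      induction this using Submodule.span_induction with
      | mem φ hφ =>
        obtain ⟨i, rfl⟩ := hφ
        have := hγ _ ⟨Pi.single i z, rfl⟩
        rw [hg] at this
        change ∑ i', ε i' (g ((Pi.single i z : Fin k → X) i')) = 0 at this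
        rwa [Finset.sum_eq_single i (fun j _ hj ↦ by simp [Pi.single_eq_of_ne hj]) (by simp),
          Pi.single_eq_same] at this
      | zero => rfl
      | add a b _ _ ha hb => rw [LinearMap.add_apply, ha, hb, add_zero]
      | smul r a _ ha => rw [LinearMap.smul_apply, ha, smul_zero]
    have h2 : g = 0 := LinearMap.ext fun z ↦ by
      by_contra h0
      obtain ⟨φ, -, hφ⟩ := exists_linearMap_ne_zero (fun m hm ↦ (hJ m hm).2)
        (W := (⊥ : Submodule R X)) (y := g z) (by simpa using h0)
      exact hφ (h1 φ z)
    exact hγα (by rw [hg, h2, map_zero])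
  -- the relations between the functionals `ε i`
  let rel : Submodule R (Fin k → Λ) :=
    { carrier := {a | ∀ z, ∑ i, ε i (a i • z) = 0}
      add_mem' {a b} ha hb z := by simp [add_smul, Finset.sum_add_distrib, ha z, hb z]
      zero_mem' z := by simp
      smul_mem' r a ha z := by simp [← Finset.smul_sum, ha z] }
  obtain ⟨l, a, ha⟩ := Submodule.fg_iff_exists_fin_generating_family.1
    (IsNoetherian.noetherian rel)
  have hmem (j : Fin l) : a j ∈ rel := ha ▸ Submodule.subset_span ⟨j, rfl⟩
  refine ⟨k, l, x, a, ?_, fun Y _ _ _ _ f hf ↦ ?_⟩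
  · rintro ⟨z, hz⟩
    -- A solution in `X` would give `α 1 = Σ ε i (x i) = 0`, since the functionals satisfy the
    -- relations `a j`.
    refine hα1 ((hx 1).trans ?_)
    simp only [Module.End.one_apply, hz, map_sum]
    rw [Finset.sum_comm]
    exact Finset.sum_eq_zero fun j _ ↦ hmem j (z j)
  let Ψ : (Fin l → Y) →ₗ[R] (Fin k → Y) :=
    { toFun z i := ∑ j, a j i • z j
      map_add' z w := by ext; simp [Finset.sum_add_distrib]
      map_smul' r z := funext fun i ↦ by
        simp only [Pi.smul_apply, Finset.smul_sum, RingHom.id_apply]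
        exact Finset.sum_congr rfl fun j _ ↦ smul_comm _ _ _ }
  by_contra hne
  -- If the system is unsolvable, `β` is a functional on DX ⊗_Λ Y nonzero at Σ ε i ⊗ f (x i). By
  -- adjunction and reflexivity of `X` it comes from the Λ-linear map `g'` with `ε i (g' y) = β
  -- (Pi.single i y)`, so its value there is `α (g' ∘ f)`. This is zero, because `g' ∘ f` is a
  -- nonunit when `f` has no retraction.
  obtain ⟨β, hβ, hβx⟩ := exists_linearMap_ne_zero (fun m hm ↦ (hJ m hm).2)
    (W := LinearMap.range Ψ) (y := fun i ↦ f (x i)) (fun ⟨z, hz⟩ ↦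
      hne ⟨z, fun i ↦ (congrFun hz i).symm⟩)
  have hrel (μ : Fin k → Λ) (hμ : μ ∈ rel) (y : Y) : β (fun i ↦ μ i • y) = 0 := by
    rw [← ha] at hμ
    obtain ⟨c, rfl⟩ := (Submodule.mem_span_range_iff_exists_fun R).1 hμ
    refine hβ _ ⟨fun j ↦ c j • y, funext fun i ↦ ?_⟩
    simp only [Ψ, LinearMap.coe_mk, AddHom.coe_mk, Finset.sum_apply, Pi.smul_apply, Finset.sum_smul]
    exact Finset.sum_congr rfl fun j _ ↦ by rw [smul_comm, smul_assoc]
  have hsum (y : Fin k → Y) : β y = ∑ i, β (Pi.single i (y i)) := by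
    rw [← map_sum, Finset.univ_sum_single]
  have hex (y : Y) : ∃ z : X, ∀ i, ε i z = β (Pi.single i y) := by
    let P : (Fin k → R) →ₗ[R] (X →ₗ[R] J) := Fintype.linearCombination R ε
    have hP : Function.Surjective P := by
      rw [← LinearMap.range_eq_top, Fintype.range_linearCombination, hε]
    let b : (Fin k → R) →ₗ[R] J := Fintype.linearCombination R fun i ↦ β (Pi.single i y)
    have hle : LinearMap.ker P ≤ LinearMap.ker b := fun c hc ↦ by
      have h1 : (fun i ↦ algebraMap R Λ (c i)) ∈ rel := fun z ↦ by
        have := congr($(LinearMap.mem_ker.1 hc) z)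
        simpa [P, Fintype.linearCombination_apply] using this
      have h2 := hrel _ h1 y
      rw [hsum] at h2
      simpa [b, Fintype.linearCombination_apply, Pi.single_smul] using h2
    obtain ⟨z, hz⟩ := exists_eq_eval hJ
      ((LinearMap.ker P).liftQ b hle ∘ₗ (P.quotKerEquivOfSurjective hP).symm.toLinearMap)
    refine ⟨z, fun i ↦ ?_⟩
    have h1 : P (Pi.single i 1) = ε i := by simp [P]
    have h2 : (P.quotKerEquivOfSurjective hP).symm (ε i) =
        Submodule.Quotient.mk (Pi.single i 1) := by
      rw [LinearEquiv.symm_apply_eq, ← h1]; rfl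
    rw [← hz, LinearMap.comp_apply, LinearEquiv.coe_coe, h2, Submodule.liftQ_apply]
    simp [b]
  choose g hg using hex
  have hsep (z w : X) (h : ∀ i, ε i z = ε i w) : z = w := by
    by_contra hzw
    obtain ⟨φ, -, hφ⟩ := exists_linearMap_ne_zero (fun m hm ↦ (hJ m hm).2)
      (W := (⊥ : Submodule R X)) (y := z - w) (by simpa [sub_eq_zero] using hzw)
    obtain ⟨c, rfl⟩ := (Submodule.mem_span_range_iff_exists_fun R).1
      (hε ▸ Submodule.mem_top : φ ∈ Submodule.span R (Set.range ε))
    exact hφ (by simp [h])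
  let g' : Y →ₗ[Λ] X :=
    { toFun := g
      map_add' y w := hsep _ _ fun i ↦ by rw [map_add, hg, hg, hg, Pi.single_add, map_add]
      map_smul' r y := hsep _ _ fun i ↦ by
        obtain ⟨c, hc⟩ := (Submodule.mem_span_range_iff_exists_fun R).1
          (hε ▸ Submodule.mem_top : ε i ∘ₗ DistribSMul.toLinearMap R X r ∈
            Submodule.span R (Set.range ε))
        have hc' (z : X) : ∑ m, c m • ε m z = ε i (r • z) := by simpa using congr($hc z)
        have h1 : (fun m ↦ (Pi.single i r : Fin k → Λ) m - algebraMap R Λ (c m)) ∈ rel := fun z ↦ by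
          rw [Finset.sum_congr rfl fun m _ ↦ by
            rw [sub_smul, map_sub, algebraMap_smul, (ε m).map_smul], Finset.sum_sub_distrib, hc',
            Finset.sum_eq_single i (fun j _ hj ↦ by simp [Pi.single_eq_of_ne hj]) (by simp),
            Pi.single_eq_same, sub_self]
        have h2 := hrel _ h1 y
        have h3 : (fun m ↦ ((Pi.single i r : Fin k → Λ) m - algebraMap R Λ (c m)) • y) =
            Pi.single i (r • y) - fun m ↦ c m • y := funext fun m ↦ by
          rw [sub_smul, algebraMap_smul, Pi.sub_apply]
          by_cases hm : m = i
          · subst hm; simp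
          · simp [Pi.single_eq_of_ne hm]
        rw [h3, map_sub, sub_eq_zero, hsum (fun m ↦ c m • y)] at h2
        rw [hg, h2, RingHom.id_apply, ← hc']
        exact Finset.sum_congr rfl fun m _ ↦ by rw [Pi.single_smul, map_smul, hg] }
  have h1 : β (fun i ↦ f (x i)) = α (g' ∘ₗ f) := by
    rw [hx, hsum]
    exact Finset.sum_congr rfl fun i _ ↦ (hg _ i).symm
  refine hβx (h1.trans (hα _ fun hu ↦ ?_))
  obtain ⟨g'', hg''⟩ := isUnit_comp_of_split hu
  exact hf g'' hg''

/-- A product of morphisms starting at a module with local endomorphism ring over an artin algebra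
is a split monomorphism only if one of the morphisms is. -/
lemma exists_retraction_of_pi [IsArtinAlgebra Λ] {X : Type u} [AddCommGroup X]
    [Module Λ X] [Module.Finite Λ X] [IsLocalRing (Module.End Λ X)] {ι : Type u} {Y : ι → Type u}
    [∀ i, AddCommGroup (Y i)] [∀ i, Module Λ (Y i)] (f : ∀ i, X →ₗ[Λ] Y i)
    (ρ : (∀ i, Y i) →ₗ[Λ] X) (h : ρ ∘ₗ LinearMap.pi f = LinearMap.id) :
    ∃ (i : ι) (g : Y i →ₗ[Λ] X), g ∘ₗ f i = LinearMap.id := by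
  obtain ⟨S, _, _, _, _⟩ := IsArtinAlgebra.exists_finite (Λ := Λ)
  let : Module S X := Module.compHom X (algebraMap S Λ)
  have : IsScalarTower S Λ X := ⟨fun a b x ↦ by rw [Algebra.smul_def, mul_smul]; rfl⟩
  let _ : ∀ i, Module S (Y i) := fun i ↦ Module.compHom (Y i) (algebraMap S Λ)
  have _ : ∀ i, IsScalarTower S Λ (Y i) := fun i ↦ ⟨fun a b x ↦ by rw [Algebra.smul_def, mul_smul]; rfl⟩
  obtain ⟨k, l, x, a, hX, hY⟩ := exists_linear_system (R := S) (Λ := Λ) X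
  by_contra! hne
  choose z hz using fun i ↦ hY (Y i) (f i) (hne i)
  -- The system does not depend on the target, so solutions in the `Y i` assemble to one in the
  -- product, and `ρ` carries it to a forbidden solution in `X`.
  refine hX ⟨fun j ↦ ρ fun i ↦ z i j, fun m ↦ ?_⟩
  rw [← LinearMap.id_apply (R := Λ) (x m), ← h]
  simp_rw [← map_smul, ← map_sum]
  refine congrArg ρ (funext fun i ↦ ?_)
  simp [hz]

lemma isArtinianRing_of_isArtinAlgebra (Λ : Type u) [Ring Λ] [h : IsArtinAlgebra Λ] :
    IsArtinianRing Λ := by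
  obtain ⟨R, _, _, _, _⟩ := h.exists_finite
  exact IsArtinianRing.of_finite R Λ

end Isolation

/-! ### Fitting's lemma and decompositions into modules with local endomorphism rings. -/

section KrullSchmidt

variable {Λ : Type u} [Ring Λ]

/-- Fitting's lemma: for large `m`, the kernel and image of `f ^ m` are complementary, so `f` is a
unit or nilpotent. -/
lemma isLocalRing_end {X : Type*} [AddCommGroup X] [Module Λ X] [IsNoetherian Λ X]
    [IsArtinian Λ X] [Nontrivial X]
    (h : ∀ A B : Submodule Λ X, IsCompl A B → A = ⊥ ∨ B = ⊥) :
    IsLocalRing (Module.End Λ X) := by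
  refine .of_isUnit_or_isUnit_one_sub_self fun f ↦ ?_
  obtain ⟨m, hm0, hm⟩ := (f.eventually_isCompl_ker_pow_range_pow.and
    (Filter.eventually_gt_atTop 0)).exists.imp fun _ ↦ And.symm
  rcases h _ _ hm with h | h
  · refine .inl ((Module.End.isUnit_iff f).2 ?_)
    have hbij : Function.Bijective (f ^ m) := by
      refine ⟨LinearMap.ker_eq_bot.1 h, LinearMap.range_eq_top.1 ?_⟩
      simpa [h] using hm.sup_eq_top
    exact (Module.End.isUnit_iff f).1 ((isUnit_pow_iff hm0.ne').1 ((Module.End.isUnit_iff _).2 hbij))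
  · have : f ^ m = 0 := LinearMap.range_eq_bot.1 h
    exact .inr (IsNilpotent.isUnit_one_sub ⟨m, this⟩)

lemma exists_decomposition [IsNoetherianRing Λ] [IsArtinianRing Λ] (U : FGModuleCat.{u} Λ) :
    ∃ (ι : Type) (_ : Fintype ι) (Z : ι → FGModuleCat.{u} Λ)
      (p : ∀ t, U.obj →ₗ[Λ] (Z t).obj) (q : ∀ t, (Z t).obj →ₗ[Λ] U.obj),
      (∀ t, IsLocalRing (Module.End Λ (Z t).obj)) ∧ (∀ t, p t ∘ₗ q t = LinearMap.id) ∧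
        ∑ t, q t ∘ₗ p t = LinearMap.id := by
  generalize hl : Module.length Λ U.obj = l
  induction l using WellFoundedLT.induction generalizing U with
  | ind l ih =>
    subst hl
    have : Module.Finite Λ U.obj := U.property
    rcases subsingleton_or_nontrivial U.obj with hU | hU
    · exact ⟨Empty, inferInstance, fun t ↦ t.elim, fun t ↦ t.elim, fun t ↦ t.elim,
        fun t ↦ t.elim, fun t ↦ t.elim, Subsingleton.elim _ _⟩
    by_cases h : ∀ A B : Submodule Λ U.obj, IsCompl A B → A = ⊥ ∨ B = ⊥
    · exact ⟨Unit, inferInstance, fun _ ↦ U, fun _ ↦ LinearMap.id, fun _ ↦ LinearMap.id,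
        fun _ ↦ isLocalRing_end h, fun _ ↦ rfl, by simp⟩
    push Not at h
    obtain ⟨A, B, hAB, hA, hB⟩ := h
    have hA' : A ≠ ⊤ := fun h ↦ hB (by simpa [h] using hAB.inf_eq_bot)
    have hB' : B ≠ ⊤ := fun h ↦ hA (by simpa [h] using hAB.inf_eq_bot)
    obtain ⟨ι₁, _, Z₁, p₁, q₁, hZ₁, hpq₁, hs₁⟩ := ih _ (Submodule.length_lt hA') (FGModuleCat.of Λ A) rfl
    obtain ⟨ι₂, _, Z₂, p₂, q₂, hZ₂, hpq₂, hs₂⟩ := ih _ (Submodule.length_lt hB') (FGModuleCat.of Λ B) rfl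
    let πA := A.projectionOnto B hAB
    let πB := B.projectionOnto A hAB.symm
    refine ⟨ι₁ ⊕ ι₂, inferInstance, Sum.elim Z₁ Z₂,
      fun t ↦ match t with | .inl t => p₁ t ∘ₗ πA | .inr t => p₂ t ∘ₗ πB,
      fun t ↦ match t with | .inl t => A.subtype ∘ₗ q₁ t | .inr t => B.subtype ∘ₗ q₂ t, ?_, ?_, ?_⟩
    · rintro (t | t)
      exacts [hZ₁ t, hZ₂ t]
    · rintro (t | t)
      · refine LinearMap.ext fun x ↦ ?_
        refine (congrArg _ (Submodule.projectionOnto_apply_left _ _)).trans ?_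
        exact congr($(hpq₁ t) x)
      · refine LinearMap.ext fun x ↦ ?_
        refine (congrArg _ (Submodule.projectionOnto_apply_left _ _)).trans ?_
        exact congr($(hpq₂ t) x)
    · refine LinearMap.ext fun x ↦ ?_
      have h1 := congrArg A.subtype congr($hs₁ (πA x))
      have h2 := congrArg B.subtype congr($hs₂ (πB x))
      rw [LinearMap.sum_apply, map_sum] at h1 h2
      rw [LinearMap.sum_apply, Fintype.sum_sum_type]
      exact (congr($h1 + $h2)).trans (Submodule.projection_add_projection_eq_self hAB x)

end KrullSchmidt

/-! ### T-nilpotence and direct sum decompositions. -/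

section TNilpotent

variable {Λ : Type u} [Ring Λ]

/-- Sequences of morphisms between modules in `M` with local endomorphism rings, none of which is
a split monomorphism, eventually annihilate every element. -/
def IsTNilpotent (M : ObjectProperty (FGModuleCat.{u} Λ)) : Prop :=
  ∀ (Y : ℕ → FGModuleCat.{u} Λ) (f : ∀ k, (Y k).obj →ₗ[Λ] (Y (k + 1)).obj) (y : ∀ k, (Y k).obj),
    (∀ k, M (Y k)) → (∀ k, IsLocalRing (Module.End Λ (Y k).obj)) →
    (∀ k (g : (Y (k + 1)).obj →ₗ[Λ] (Y k).obj), g ∘ₗ f k ≠ LinearMap.id) →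
    (∀ k, f k (y k) = y (k + 1)) → ∃ k, y k = 0

section

variable {M : ObjectProperty (FGModuleCat.{u} Λ)} {n : ℕ}

/-- The form in which T-nilpotence is applied: marked modules from each of which a nonsplit step
leads to another, with nonzero marked elements, would give an infinite forbidden sequence. -/
lemma IsTNilpotent.isEmpty (h : IsTNilpotent M) {α : Type*} (Y : α → FGModuleCat.{u} Λ)
    (hY : ∀ s, M (Y s)) (hloc : ∀ s, IsLocalRing (Module.End Λ (Y s).obj)) (y : ∀ s, (Y s).obj)
    (hy : ∀ s, y s ≠ 0)
    (step : ∀ s, ∃ s', ∃ f : (Y s).obj →ₗ[Λ] (Y s').obj,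
      (∀ g : (Y s').obj →ₗ[Λ] (Y s).obj, g ∘ₗ f ≠ LinearMap.id) ∧ f (y s) = y s') : IsEmpty α := by
  choose next f hf hfy using step
  refine ⟨fun s ↦ ?_⟩
  let σ : ℕ → α := fun k ↦ Nat.rec s (fun _ ↦ next) k
  obtain ⟨k, hk⟩ := h (fun k ↦ Y (σ k)) (fun k ↦ f (σ k)) (fun k ↦ y (σ k)) (fun k ↦ hY _)
    (fun k ↦ hloc _) (fun k ↦ hf _) (fun k ↦ hfy _)
  exact hy _ hk

lemma nontrivial_of_isLocalRing_end {X : Type*} [AddCommGroup X] [Module Λ X]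
    [IsLocalRing (Module.End Λ X)] : Nontrivial X := by
  by_contra h
  have := not_nontrivial_iff_subsingleton.1 h
  exact one_ne_zero (α := Module.End Λ X) (LinearMap.ext fun x ↦ Subsingleton.elim _ _)

variable [IsNoetherianRing Λ] [IsArtinianRing Λ]

/-- Pigeonhole: each `h i` is nonzero on a component of `x` in one of finitely many summands. -/
lemma IsNClusterTilting.exists_local_summand (hM : IsNClusterTilting n M) {U : FGModuleCat.{u} Λ}
    (hU : M U) {ι : Type*} [Infinite ι] {X : ι → Type*} [∀ i, AddCommGroup (X i)]
    [∀ i, Module Λ (X i)] (h : ∀ i, U.obj →ₗ[Λ] X i) {x : U.obj} (hx : ∀ i, h i x ≠ 0) :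
    ∃ (Y : FGModuleCat.{u} Λ) (p : U.obj →ₗ[Λ] Y.obj) (q : Y.obj →ₗ[Λ] U.obj), M Y ∧
      IsLocalRing (Module.End Λ Y.obj) ∧ {i | h i (q (p x)) ≠ 0}.Infinite := by
  obtain ⟨κ, _, Z, p, q, hloc, hpq, hsum⟩ := exists_decomposition U
  have hex (i : ι) : ∃ t, h i (q t (p t x)) ≠ 0 := by
    by_contra! h0
    refine hx i ?_
    rw [← LinearMap.id_apply (R := Λ) x, ← hsum, LinearMap.sum_apply, map_sum]
    exact Finset.sum_eq_zero fun t _ ↦ h0 t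
  choose t ht using hex
  obtain ⟨s, hs⟩ := Finite.exists_infinite_fiber t
  exact ⟨Z s, p s, q s, hM.mem_of_retract hU _ _ (hpq s), hloc s,
    (Set.infinite_coe_iff.1 hs).mono fun i hi ↦ by
      have := ht i
      rwa [show t i = s from hi] at this⟩

lemma IsNClusterTilting.exists_local_summand_ne_zero (hM : IsNClusterTilting n M)
    {U : FGModuleCat.{u} Λ}
    (hU : M U) {X : Type*} [AddCommGroup X] [Module Λ X] (h : U.obj →ₗ[Λ] X) {x : U.obj}
    (hx : h x ≠ 0) :
    ∃ (Y : FGModuleCat.{u} Λ) (p : U.obj →ₗ[Λ] Y.obj) (q : Y.obj →ₗ[Λ] U.obj), M Y ∧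
      IsLocalRing (Module.End Λ Y.obj) ∧ h (q (p x)) ≠ 0 := by
  obtain ⟨Y, p, q, hY, hloc, hi⟩ := hM.exists_local_summand hU (ι := ℕ) (fun _ ↦ h) (fun _ ↦ hx)
  exact ⟨Y, p, q, hY, hloc, hi.nonempty.some_mem⟩

/-! ### Decompositions of filtered colimits -/

/-- A nonzero filtered colimit of modules in `M` receives a morphism from an indecomposable module
in `M` which only factors through `M` via split monomorphisms. -/
lemma IsTNilpotent.exists_morphism (h : IsTNilpotent M) (hM : IsNClusterTilting n M) {C : Type u}
    [AddCommGroup C] [Module Λ C] [Nontrivial C] :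
    ∃ (X : FGModuleCat.{u} Λ) (u : X.obj →ₗ[Λ] C), M X ∧ Nontrivial X.obj ∧
      ∀ (V : FGModuleCat.{u} Λ) (a : X.obj →ₗ[Λ] V.obj) (b : V.obj →ₗ[Λ] C), M V → b ∘ₗ a = u →
        ∃ g : V.obj →ₗ[Λ] X.obj, g ∘ₗ a = LinearMap.id := by
  by_contra! hno
  -- The states are indecomposables of `M` with an element that survives in `C`. A factorization
  -- without retraction, followed by projection to a summand on which the element still survives, is
  -- a step.
  let P : (Σ X : FGModuleCat.{u} Λ, X.obj × (X.obj →ₗ[Λ] C)) → Prop := fun s ↦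
    M s.1 ∧ IsLocalRing (Module.End Λ s.1.obj) ∧ s.2.2 s.2.1 ≠ 0
  have hempty := h.isEmpty (α := Subtype P) (fun s ↦ s.1.1) (fun s ↦ s.2.1)
    (fun s ↦ s.2.2.1) (fun s ↦ s.1.2.1) (fun s hs ↦ s.2.2.2 (by rw [hs, map_zero])) ?_
  · obtain ⟨c, hc⟩ := exists_ne (0 : C)
    obtain ⟨Y, p, q, hY, hloc, hi⟩ := hM.exists_local_summand_ne_zero hM.mem_self
      (LinearMap.toSpanSingleton Λ C c) (x := (1 : Λ)) (by simpa using hc)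
    exact hempty.false ⟨⟨Y, p (1 : Λ), LinearMap.toSpanSingleton Λ C c ∘ₗ q⟩, hY, hloc, hi⟩
  · rintro ⟨⟨X, x, u⟩, hX, hloc, hx⟩
    have : Nontrivial X.obj := nontrivial_of_isLocalRing_end (Λ := Λ)
    obtain ⟨V, a, b, hV, rfl, hsplit⟩ := hno X u hX this
    obtain ⟨Y, p, q, hY, hlocY, hi⟩ := hM.exists_local_summand_ne_zero hV b (x := a x) hx
    exact ⟨⟨⟨Y, p (a x), b ∘ₗ q⟩, hY, hlocY, hi⟩, p ∘ₗ a, fun g hg ↦ hsplit (g ∘ₗ p) hg, rfl⟩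

lemma IsTNilpotent.exists_isPureSubmodule_range (h : IsTNilpotent M) (hM : IsNClusterTilting n M)
    {C : Type u} [AddCommGroup C] [Module Λ C] [Nontrivial C] (hC : lim M (ModuleCat.of Λ C)) :
    ∃ (X : FGModuleCat.{u} Λ) (u : X.obj →ₗ[Λ] C), M X ∧ Nontrivial X.obj ∧
      Function.Injective u ∧ IsPureSubmodule (LinearMap.range u) := by
  obtain ⟨X, u, hX, hnt, hu⟩ := h.exists_morphism hM (C := C)
  have : Module.Finite Λ X.obj := X.property
  have key (k : ℕ) (K : Submodule Λ (Fin k → Λ)) (l : (Fin k → Λ) →ₗ[Λ] C)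
      (hK : K.map l ≤ LinearMap.range u) : Function.Injective u ∧
      ∃ l' : (Fin k → Λ) →ₗ[Λ] C, K ≤ LinearMap.ker l' ∧ ∀ x, l x - l' x ∈ LinearMap.range u := by
    -- The quotient by `T` is the pushout of `X` and Λ^k over the constants of the system, and it
    -- maps to `C`. Factoring this map through `M` and applying the defining property of `u` yields
    -- a retraction `g` onto `X`; it moves the solution `l` into the image of `u`.
    let T : Submodule Λ (X.obj × (Fin k → Λ)) :=
      LinearMap.ker (u.coprod l) ⊓ K.comap (LinearMap.snd Λ _ _)
    obtain ⟨V, a, b, hV, hab⟩ := hC.exists_factorization (T.liftQ (u.coprod l) inf_le_left)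
    obtain ⟨g, hg⟩ := hu V (a ∘ₗ T.mkQ ∘ₗ LinearMap.inl Λ _ _) b hV (LinearMap.ext fun x ↦
      (congr($hab (T.mkQ (x, 0)))).trans (by
        rw [Submodule.mkQ_apply, Submodule.liftQ_apply]; simp))
    have hT (x : X.obj) (m : Fin k → Λ) (hm : m ∈ K) (hx : u x + l m = 0) :
        g (a (T.mkQ (0, m))) = - x := by
      have h0 : T.mkQ (x, m) = 0 := (Submodule.Quotient.mk_eq_zero T).2 ⟨by simpa using hx, hm⟩
      have h1 : T.mkQ (0, m) = - T.mkQ (x, 0) := by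
        rw [eq_neg_iff_add_eq_zero, ← map_add, Prod.mk_add_mk, zero_add, add_zero, h0]
      rw [h1, map_neg, map_neg]
      exact congrArg _ congr($hg x)
    refine ⟨?_, l - u ∘ₗ g ∘ₗ a ∘ₗ T.mkQ ∘ₗ LinearMap.inr Λ _ _, fun m hm ↦ ?_, fun m ↦ ?_⟩
    · rw [← LinearMap.ker_eq_bot, LinearMap.ker_eq_bot']
      intro x hx
      have := hT x 0 K.zero_mem (by rw [hx, map_zero, add_zero])
      rw [← neg_eq_zero, ← this, show ((0 : X.obj), (0 : Fin k → Λ)) = 0 from rfl, map_zero,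
        map_zero, map_zero]
    · obtain ⟨x, hx⟩ := hK ⟨m, hm, rfl⟩
      have := hT (-x) m hm (by rw [map_neg, hx, neg_add_cancel])
      rw [neg_neg] at this
      rw [LinearMap.mem_ker, LinearMap.sub_apply, sub_eq_zero, ← hx]
      exact congrArg u this.symm
    · rw [LinearMap.sub_apply, sub_sub_cancel]
      exact ⟨_, rfl⟩
  exact ⟨X, u, hX, hnt, (key 0 ⊥ 0 (by simp)).1,
    isPureSubmodule_iff.2 fun k K l hK ↦ (key k K l hK).2⟩

end

section Pure

variable [IsNoetherianRing Λ] {C : Type u} [AddCommGroup C] [Module Λ C]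

lemma isPureSubmodule_sSup_of_directedOn {c : Set (Submodule Λ C)} (hne : c.Nonempty)
    (hc : DirectedOn (· ≤ ·) c) (h : ∀ N ∈ c, IsPureSubmodule N) : IsPureSubmodule (sSup c) := by
  refine isPureSubmodule_iff.2 fun k K l hl ↦ ?_
  have hfg : (K.map l).FG := (IsNoetherian.noetherian K).map l
  obtain ⟨N, hN, hle⟩ := (CompleteLattice.isCompactElement_iff_le_of_directed_sSup_le _ _).1
    ((Submodule.fg_iff_compact _).1 hfg) c hne hc hl
  obtain ⟨l', hl', hN'⟩ := isPureSubmodule_iff.1 (h N hN) k K l hle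
  exact ⟨l', hl', fun x ↦ le_sSup hN (hN' x)⟩

lemma isPureSubmodule_comap_mkQ {S : Submodule Λ C} (hS : IsPureSubmodule S)
    {N : Submodule Λ (C ⧸ S)} (hN : IsPureSubmodule N) : IsPureSubmodule (N.comap S.mkQ) := by
  refine isPureSubmodule_iff.2 fun k K l hl ↦ ?_
  obtain ⟨l₁, hK₁, hl₁⟩ := isPureSubmodule_iff.1 hN k K (S.mkQ ∘ₗ l) (by
    rwa [Submodule.map_comp, Submodule.map_le_iff_le_comap])
  obtain ⟨l₂, rfl⟩ := Module.projective_lifting_property S.mkQ l₁ S.mkQ_surjective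
  obtain ⟨l₃, hK₃, hl₃⟩ := isPureSubmodule_iff.1 hS k K l₂ (by
    rintro _ ⟨x, hx, rfl⟩
    exact (Submodule.Quotient.mk_eq_zero S).1 (hK₁ hx))
  refine ⟨l₃, hK₃, fun x ↦ ?_⟩
  have h1 : S.mkQ (l₃ x) = S.mkQ (l₂ x) := ((Submodule.Quotient.eq S).2 (hl₃ x)).symm
  rw [Submodule.mem_comap, map_sub, h1]
  exact hl₁ x

end Pure

variable {M : ObjectProperty (FGModuleCat.{u} Λ)} {n : ℕ} [IsNoetherianRing Λ] [IsArtinianRing Λ]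

lemma IsTNilpotent.lim_le_add (h : IsTNilpotent M) (hM : IsNClusterTilting n M) :
    lim M ≤ Add M := by
  classical
  intro C hC
  -- Independence is required on finite subfamilies so that it survives unions of chains; purity of
  -- the sum makes the quotient stay in `lim M`.
  let P : Set (Set (Submodule Λ C)) := {𝓕 | (∀ t : Finset (Submodule Λ C), (t : Set _) ⊆ 𝓕 →
    t.SupIndep id) ∧ (∀ N ∈ 𝓕, ∃ _ : Module.Finite Λ N, M (FGModuleCat.of Λ N)) ∧
    IsPureSubmodule (sSup 𝓕)}
  obtain ⟨𝓕, h𝓕⟩ := zorn_subset P fun c hcP hc ↦ by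
    rcases c.eq_empty_or_nonempty with rfl | hne
    · refine ⟨∅, ⟨fun t ht ↦ ?_, by simp, ?_⟩, by simp⟩
      · rw [Finset.coe_eq_empty.1 (Set.subset_empty_iff.1 ht)]
        exact Finset.supIndep_empty _
      · rw [sSup_empty]
        exact isPureSubmodule_iff.2 fun k K l hl ↦ ⟨l, fun x hx ↦ hl ⟨x, hx, rfl⟩, by simp⟩
    refine ⟨⋃₀ c, ⟨fun t ht ↦ ?_, fun N hN ↦ ?_, ?_⟩, fun s hs ↦ Set.subset_sUnion_of_mem hs⟩
    · obtain ⟨s, hs, hts⟩ := hc.directedOn.exists_mem_subset_of_finset_subset_biUnion hne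
        (f := id) (by simpa [Set.sUnion_eq_biUnion] using ht)
      exact (hcP hs).1 t hts
    · obtain ⟨s, hs, hNs⟩ := hN
      exact (hcP hs).2.1 N hNs
    · rw [sSup_sUnion, ← sSup_image]
      refine isPureSubmodule_sSup_of_directedOn (hne.image _) ?_ ?_
      · rintro _ ⟨s, hs, rfl⟩ _ ⟨t, ht, rfl⟩
        obtain ⟨r, hr, hsr, htr⟩ := hc.directedOn s hs t ht
        exact ⟨_, ⟨r, hr, rfl⟩, sSup_le_sSup hsr, sSup_le_sSup htr⟩
      · rintro _ ⟨s, hs, rfl⟩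
        exact (hcP hs).2.2
  obtain ⟨hind, hmem, hpure⟩ := h𝓕.prop
  have htop : sSup 𝓕 = ⊤ := by
    by_contra htop
    have := Submodule.Quotient.nontrivial_iff.2 htop
    obtain ⟨X, u, hX, hnt, hu, hur⟩ :=
      h.exists_isPureSubmodule_range hM (C := C ⧸ sSup 𝓕) (hC.quotient hpure)
    have : Module.Finite Λ X.obj := X.property
    have := Module.finitePresentation_of_finite Λ X.obj
    -- Purity lifts the pure submodule `X` of the quotient to `C`, where it is independent of the
    -- family and enlarges it, against maximality.
    obtain ⟨u', rfl⟩ := hpure X.obj u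
    have hu' : Function.Injective u' := fun x y hxy ↦ hu congr((sSup 𝓕).mkQ $hxy)
    have hdisj : Disjoint (LinearMap.range u') (sSup 𝓕) := by
      rw [Submodule.disjoint_def]
      rintro _ ⟨x, rfl⟩ hx
      have : x = 0 := hu (by
        rw [map_zero]
        exact (Submodule.Quotient.mk_eq_zero (sSup 𝓕)).2 hx)
      rw [this, map_zero]
    have hP : insert (LinearMap.range u') 𝓕 ∈ P := by
      refine ⟨fun t ht ↦ ?_, ?_, ?_⟩
      · have hsub : ((t.erase (LinearMap.range u') : Finset _) : Set (Submodule Λ C)) ⊆ 𝓕 := by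
          rw [Finset.coe_erase, Set.sdiff_singleton_subset_iff]
          exact ht
        refine ((hind _ hsub).insert (i := LinearMap.range u') (hdisj.mono_right ?_)).subset ?_
        · rw [Finset.sup_id_eq_sSup]
          exact sSup_le_sSup hsub
        · exact Finset.insert_erase_subset _ _
      · rintro N (rfl | hN)
        · let e := LinearEquiv.ofInjective u' hu'
          exact ⟨inferInstance, hM.mem_of_retract hX e.symm.toLinearMap e.toLinearMap (by
            ext x; simp)⟩
        · exact hmem N hN
      · have : sSup (insert (LinearMap.range u') 𝓕) =
            (LinearMap.range ((sSup 𝓕).mkQ ∘ₗ u')).comap (sSup 𝓕).mkQ := by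
          rw [LinearMap.range_comp, Submodule.comap_map_mkQ, sSup_insert, sup_comm]
        rw [this]
        exact isPureSubmodule_comap_mkQ hpure hur
    have hle : LinearMap.range u' ≤ sSup 𝓕 :=
      le_sSup (h𝓕.le_of_ge hP (Set.subset_insert _ _) (Set.mem_insert _ _))
    have h0 : LinearMap.range u' = ⊥ := hdisj.eq_bot_of_le hle
    obtain ⟨x, hx⟩ := exists_ne (0 : X.obj)
    exact hx (hu' (by rw [map_zero]; exact (Submodule.mem_bot Λ).1 (h0 ▸ ⟨x, rfl⟩)))
  have hint := DirectSum.isInternal_submodule_of_iSupIndep_of_iSup_eq_top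
    (A := fun N : 𝓕 ↦ (N : Submodule Λ C)) (iSupIndep_iff_supIndep.2 fun t ↦
      Finset.supIndep_map.1 (hind (t.map (Function.Embedding.subtype _)) (by simp))) (by rw [← sSup_eq_iSup', htop])
  let e := LinearEquiv.ofBijective (DirectSum.coeLinearMap fun N : 𝓕 ↦ (N : Submodule Λ C)) hint
  have hfin (N : 𝓕) : Module.Finite Λ N := (hmem N N.2).1
  exact ⟨𝓕, fun N ↦ FGModuleCat.of Λ N, fun N ↦ (hmem N N.2).2,
    ⟨⟨ModuleCat.ofHom e.symm.toLinearMap, ModuleCat.ofHom e.toLinearMap, by ext x; simp⟩⟩⟩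

end TNilpotent

/-! ### T-nilpotence from finite type and from the splitting of pure submodules. -/

section Radical

variable {Λ : Type u} [Ring Λ] {M : ObjectProperty (FGModuleCat.{u} Λ)} {n : ℕ}

section LocalRing

variable {E : Type*} [Ring E] [IsLocalRing E]

lemma isUnit_one_sub_of_not_isUnit {a : E} (ha : ¬ IsUnit a) : IsUnit (1 - a) :=
  (IsLocalRing.isUnit_or_isUnit_of_isUnit_add (a := a) (b := 1 - a) (by simp)).resolve_left ha

lemma exists_isUnit_of_sum_eq_one {ι : Type*} {s : Finset ι} {a : ι → E}
    (h : ∑ i ∈ s, a i = 1) : ∃ i ∈ s, IsUnit (a i) := by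
  by_contra! hne
  have : ∀ t ⊆ s, ¬ IsUnit (∑ i ∈ t, a i) := by
    classical
    intro t
    induction t using Finset.induction_on with
    | empty => simp
    | insert j t hj ih =>
      intro ht hu
      rw [Finset.sum_insert hj] at hu
      rcases IsLocalRing.isUnit_or_isUnit_of_isUnit_add hu with hu | hu
      · exact hne j (ht (Finset.mem_insert_self _ _)) hu
      · exact ih ((Finset.subset_insert _ _).trans ht) hu
  exact this s subset_rfl (h ▸ isUnit_one)

end LocalRing

lemma isArtinianRing_end [IsArtinAlgebra Λ] (G : Type u) [AddCommGroup G]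
    [Module Λ G] [Module.Finite Λ G] : IsArtinianRing (Module.End Λ G) := by
  obtain ⟨S, _, _, _, _⟩ := IsArtinAlgebra.exists_finite (Λ := Λ)
  let : Module S G := Module.compHom G (algebraMap S Λ)
  have : IsScalarTower S Λ G := ⟨fun a b x ↦ by rw [Algebra.smul_def, mul_smul]; rfl⟩
  have := finite_end S Λ G
  exact IsArtinianRing.of_finite S _

/-- Products of radical morphisms between summands of a module `G` with artinian endomorphism ring
vanish eventually. -/
lemma isTNilpotent_of_retract (G : Type*) [AddCommGroup G] [Module Λ G]
    [IsArtinianRing (Module.End Λ G)]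
    (hG : ∀ Y : FGModuleCat.{u} Λ, M Y → IsLocalRing (Module.End Λ Y.obj) →
      ∃ (a : Y.obj →ₗ[Λ] G) (b : G →ₗ[Λ] Y.obj), b ∘ₗ a = LinearMap.id) : IsTNilpotent M := by
  intro Y f y hY hloc hf hy
  choose a b hba using fun k ↦ hG (Y k) (hY k) (hloc k)
  have hab (k : ℕ) (z : (Y k).obj) : b k (a k z) = z := congr($(hba k) z)
  let e (k : ℕ) : Module.End Λ G := a (k + 1) ∘ₗ f k ∘ₗ b k
  have hrad (k : ℕ) : e k ∈ Ring.jacobson (Module.End Λ G) := by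
    rw [← Ideal.jacobson_bot, Ideal.mem_jacobson_iff]
    intro h
    let c : Module.End Λ (Y k).obj := (- (b k ∘ₗ h ∘ₗ a (k + 1))) ∘ₗ f k
    have hc : ¬ IsUnit c := fun hc ↦ by
      obtain ⟨g, hg⟩ := isUnit_comp_of_split hc
      exact hf k g hg
    obtain ⟨w, hw⟩ := isUnit_one_sub_of_not_isUnit hc
    let w' : Module.End Λ (Y k).obj := ↑w⁻¹
    have hw' (z : (Y k).obj) : w' (z + b k (h (a (k + 1) (f k z)))) = z := by
      have h1 : w' * (1 - c) = 1 := by rw [← hw]; exact w.inv_mul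
      have : w' ((1 - c) z) = z := congr($h1 z)
      simpa [c] using this
    -- The identity (1 + xy)⁻¹ = 1 - x(1 + yx)⁻¹y with x = h a f and y = b; here 1 + yx is `1 - c`,
    -- a unit of the local ring End(Y k).
    refine ⟨1 - h ∘ₗ a (k + 1) ∘ₗ f k ∘ₗ w' ∘ₗ b k, ?_⟩
    rw [Ideal.mem_bot]
    refine LinearMap.ext fun z ↦ ?_
    have := congrArg (fun t ↦ h (a (k + 1) (f k t))) (hw' (b k z))
    simp only [map_add] at this
    simp only [e, Module.End.mul_apply, LinearMap.sub_apply, LinearMap.add_apply,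
      Module.End.one_apply, LinearMap.comp_apply, LinearMap.zero_apply]
    rw [← eq_sub_iff_add_eq] at this
    rw [this]
    abel
  obtain ⟨N, hN⟩ := IsSemiprimaryRing.isNilpotent (R := Module.End Λ G)
  have hprod (k : ℕ) : ∃ φ ∈ Ring.jacobson (Module.End Λ G) ^ k, φ (a 0 (y 0)) = a k (y k) := by
    induction k with
    | zero => exact ⟨1, by rw [Submodule.pow_zero, Ideal.one_eq_top]; exact Submodule.mem_top, rfl⟩
    | succ k ih =>
      obtain ⟨φ, hφ, h⟩ := ih
      refine ⟨e k * φ, ?_, ?_⟩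
      · rw [Ideal.IsTwoSided.pow_succ]
        exact Ideal.mul_mem_mul (hrad k) hφ
      · rw [Module.End.mul_apply, h]
        simp only [e, LinearMap.comp_apply, hab, hy]
  obtain ⟨φ, hφ, h⟩ := hprod N
  refine ⟨N, ?_⟩
  rw [hN] at hφ
  rw [← hab N (y N), ← h, show φ = 0 from hφ, LinearMap.zero_apply, map_zero]

lemma sum_comp_eq_id [IsNoetherianRing Λ] [HasFiniteBiproducts (FGModuleCat.{u} Λ)]
    {Y G : FGModuleCat.{u} Λ} {k : ℕ} (r : Retract Y (⨁ fun _ : Fin k ↦ G)) :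
    ∑ j, (biproduct.ι (fun _ : Fin k ↦ G) j ≫ r.r).hom.hom ∘ₗ
      (r.i ≫ biproduct.π (fun _ : Fin k ↦ G) j).hom.hom = LinearMap.id := by
  have h1 : ∑ j, (r.i ≫ biproduct.π (fun _ : Fin k ↦ G) j) ≫
      (biproduct.ι (fun _ : Fin k ↦ G) j ≫ r.r) = 𝟙 Y := by
    have := congr(r.i ≫ $(biproduct.total (f := fun _ : Fin k ↦ G)) ≫ r.r)
    rw [Category.id_comp, r.retract] at this
    rw [← this, Preadditive.sum_comp, Preadditive.comp_sum]
    simp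
  let φ : (Y ⟶ Y) →+ Module.End Λ Y.obj :=
    { toFun g := g.hom.hom, map_zero' := rfl, map_add' _ _ := rfl }
  have h2 := congrArg φ h1
  rwa [map_sum] at h2

lemma IsOfFiniteType.isTNilpotent [IsArtinAlgebra Λ] (h : IsOfFiniteType M) : IsTNilpotent M := by
  have : HasFiniteBiproducts (FGModuleCat.{u} Λ) := Abelian.hasFiniteBiproducts
  obtain ⟨G, hG⟩ := h
  have : Module.Finite Λ G.obj := G.property
  have := isArtinianRing_end (Λ := Λ) G.obj
  refine isTNilpotent_of_retract G.obj fun Y hY hloc ↦ ?_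
  obtain ⟨k, ⟨r⟩⟩ := (hG Y).1 hY
  obtain ⟨j, -, hj⟩ := exists_isUnit_of_sum_eq_one (E := Module.End Λ Y.obj) (sum_comp_eq_id r)
  obtain ⟨g, hg⟩ := isUnit_comp_of_split hj
  exact ⟨_, g, hg⟩

/-! ### The telescope of a sequence of modules -/

section Telescope

variable {Y : ℕ → Type u} [∀ k, AddCommGroup (Y k)] [∀ k, Module Λ (Y k)]
  (f : ∀ k, Y k →ₗ[Λ] Y (k + 1))

/-- The difference of the identity and the shift given by the maps `f k`. -/
noncomputable def telescope : DirectSum ℕ Y →ₗ[Λ] DirectSum ℕ Y :=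
  LinearMap.id - DirectSum.toModule Λ ℕ _ fun k ↦ DirectSum.lof Λ ℕ Y (k + 1) ∘ₗ f k

lemma telescope_lof (k : ℕ) (x : Y k) : telescope f (DirectSum.lof Λ ℕ Y k x) =
    DirectSum.lof Λ ℕ Y k x - DirectSum.lof Λ ℕ Y (k + 1) (f k x) := by
  simp [telescope, DirectSum.toModule_lof]

lemma telescope_apply_zero (z : DirectSum ℕ Y) : telescope f z 0 = z 0 := by
  induction z using DirectSum.induction_on with
  | zero => simp
  | of k x =>
    rw [← DirectSum.lof_eq_of Λ, telescope_lof, DirectSum.sub_apply, DirectSum.lof_eq_of,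
      DirectSum.lof_eq_of, DirectSum.of_eq_of_ne (k + 1) _ _ (by omega), sub_zero]
  | add x y hx hy => rw [map_add, DirectSum.add_apply, hx, hy, DirectSum.add_apply]

lemma telescope_apply_succ (z : DirectSum ℕ Y) (j : ℕ) :
    telescope f z (j + 1) = z (j + 1) - f j (z j) := by
  induction z using DirectSum.induction_on with
  | zero => simp
  | of k x =>
    rw [← DirectSum.lof_eq_of Λ, telescope_lof, DirectSum.sub_apply]
    congr 1
    simp only [DirectSum.lof_eq_of]
    by_cases hjk : k = j
    · subst hjk
      rw [DirectSum.of_eq_same, DirectSum.of_eq_same]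
    · rw [DirectSum.of_eq_of_ne _ _ _ (by omega), DirectSum.of_eq_of_ne _ _ _ (by omega), map_zero]
  | add x y hx hy =>
    rw [map_add, DirectSum.add_apply, hx, hy, DirectSum.add_apply, DirectSum.add_apply, map_add]
    abel

lemma telescope_injective : Function.Injective (telescope f) := by
  rw [← LinearMap.ker_eq_bot, LinearMap.ker_eq_bot']
  intro z hz
  refine DFinsupp.ext fun k ↦ ?_
  induction k with
  | zero =>
    have := telescope_apply_zero f z
    rw [hz] at this
    exact this.symm
  | succ k ih =>
    have := telescope_apply_succ f z k
    rw [hz, show z k = 0 from ih, map_zero, sub_zero] at this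
    exact this.symm

lemma isPureSubmodule_range_telescope [IsNoetherianRing Λ] :
    IsPureSubmodule (LinearMap.range (telescope f)) := by
  -- `t k` pushes the `k`-th coordinate along `f k` into the next one, and `s k` does so
  -- successively for all coordinates below `k`. Both are the identity modulo the image of the
  -- telescope, and each element of that image is killed by some `s k`.
  let t (k : ℕ) : DirectSum ℕ Y →ₗ[Λ] DirectSum ℕ Y := LinearMap.id -
    telescope f ∘ₗ DirectSum.lof Λ ℕ Y k ∘ₗ DirectSum.component Λ ℕ Y k
  let s (k : ℕ) : DirectSum ℕ Y →ₗ[Λ] DirectSum ℕ Y := Nat.rec LinearMap.id (fun k s ↦ t k ∘ₗ s) k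
  have hs (k : ℕ) (x) : x - s k x ∈ LinearMap.range (telescope f) := by
    induction k with
    | zero => simp [s]
    | succ k ih =>
      have : x - s (k + 1) x = (x - s k x) + telescope f (DirectSum.lof Λ ℕ Y k (s k x k)) := by
        change x - (s k x - telescope f (DirectSum.lof Λ ℕ Y k (s k x k))) = _
        abel
      rw [this]
      exact add_mem ih ⟨_, rfl⟩
  have hmono : Monotone fun k ↦ LinearMap.ker (s k) := monotone_nat_of_le_succ fun k x hx ↦ by
    change t k (s k x) = 0
    rw [LinearMap.mem_ker.1 hx, map_zero]
  have hfix (k : ℕ) (x : Y k) (m : ℕ) (hm : m ≤ k) :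
      s m (telescope f (DirectSum.lof Λ ℕ Y k x)) = telescope f (DirectSum.lof Λ ℕ Y k x) := by
    induction m with
    | zero => rfl
    | succ m ih =>
      change t m (s m _) = _
      rw [ih (by omega)]
      have : telescope f (DirectSum.lof Λ ℕ Y k x) m = 0 := by
        rw [telescope_lof, DirectSum.sub_apply, DirectSum.lof_eq_of, DirectSum.lof_eq_of,
          DirectSum.of_eq_of_ne _ _ _ (by omega), DirectSum.of_eq_of_ne _ _ _ (by omega), sub_zero]
      change _ - telescope f (DirectSum.lof Λ ℕ Y m _) = _
      rw [DirectSum.apply_eq_component Λ] at this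
      rw [this, map_zero, map_zero, sub_zero, LinearMap.id_apply]
  have hker (z) : ∃ k, s k (telescope f z) = 0 := by
    induction z using DirectSum.induction_on with
    | zero => exact ⟨0, by simp⟩
    | of k x =>
      refine ⟨k + 1, ?_⟩
      change t k (s k (telescope f (DirectSum.lof Λ ℕ Y k x))) = 0
      rw [hfix k x k le_rfl]
      have : telescope f (DirectSum.lof Λ ℕ Y k x) k = x := by
        rw [telescope_lof, DirectSum.sub_apply, DirectSum.lof_eq_of, DirectSum.lof_eq_of,
          DirectSum.of_eq_same, DirectSum.of_eq_of_ne _ _ _ (by omega), sub_zero]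
      change _ - telescope f (DirectSum.lof Λ ℕ Y k _) = _
      rw [DirectSum.apply_eq_component Λ] at this
      rw [this, LinearMap.id_apply, sub_self]
    | add x y hx hy =>
      obtain ⟨k, hk⟩ := hx
      obtain ⟨l, hl⟩ := hy
      refine ⟨max k l, ?_⟩
      rw [map_add, map_add, hmono (le_max_left k l) hk, hmono (le_max_right k l) hl, add_zero]
  refine isPureSubmodule_of_endomorphism fun L hL hfg ↦ ?_
  have hle : L ≤ ⨆ k, LinearMap.ker (s k) := fun x hx ↦ by
    obtain ⟨z, rfl⟩ := hL hx
    obtain ⟨k, hk⟩ := hker z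
    exact Submodule.mem_iSup_of_mem k hk
  obtain ⟨_, ⟨k, rfl⟩, hk⟩ := (CompleteLattice.isCompactElement_iff_le_of_directed_sSup_le _ _).1
    ((Submodule.fg_iff_compact _).1 hfg) (Set.range fun k ↦ LinearMap.ker (s k))
    (Set.range_nonempty _) hmono.directed_le.directedOn_range hle
  exact ⟨s k, hk, hs k⟩

/-- If the telescope is a split monomorphism, then every element is killed by the composites of the
maps `f k`, as soon as no `f k` is a split monomorphism. -/
lemma exists_eq_zero_of_telescope_retraction (hloc : ∀ k, IsLocalRing (Module.End Λ (Y k)))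
    (hf : ∀ k (g : Y (k + 1) →ₗ[Λ] Y k), g ∘ₗ f k ≠ LinearMap.id)
    {r : DirectSum ℕ Y →ₗ[Λ] DirectSum ℕ Y} (hr : r ∘ₗ telescope f = LinearMap.id)
    {y : ∀ k, Y k} (hy : ∀ k, f k (y k) = y (k + 1)) : ∃ k, y k = 0 := by
  have h1 (k : ℕ) : r (DirectSum.lof Λ ℕ Y k (y k)) =
      DirectSum.lof Λ ℕ Y k (y k) + r (DirectSum.lof Λ ℕ Y (k + 1) (y (k + 1))) := by
    have := congr($hr (DirectSum.lof Λ ℕ Y k (y k)))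
    rw [LinearMap.comp_apply, telescope_lof, map_sub, sub_eq_iff_eq_add, hy] at this
    exact this
  have h2 (k j : ℕ) (hkj : k ≤ j) : r (DirectSum.lof Λ ℕ Y 0 (y 0)) j =
      r (DirectSum.lof Λ ℕ Y k (y k)) j := by
    induction k with
    | zero => rfl
    | succ k ih =>
      rw [ih (by omega), h1 k, DirectSum.add_apply, DirectSum.lof_eq_of,
        DirectSum.of_eq_of_ne _ _ _ (by omega), zero_add]
  -- Outside the finite support of `r (y 0)`, the relations `h1` and `h2` read `0 = y k + r (y (k +
  -- 1)) k = (1 - g ∘ f k) (y k)`, where `1 - g ∘ f k` is invertible.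
  obtain ⟨k, hk⟩ : ∃ k, r (DirectSum.lof Λ ℕ Y 0 (y 0)) k = 0 := by
    classical
    obtain ⟨k, hk⟩ := Infinite.exists_notMem_finset (DFinsupp.support (r (DirectSum.lof Λ ℕ Y 0 (y 0))))
    exact ⟨k, DFinsupp.notMem_support_iff.1 hk⟩
  refine ⟨k, ?_⟩
  rw [h2 k k le_rfl, h1, DirectSum.add_apply, DirectSum.lof_eq_of, DirectSum.of_eq_same] at hk
  let g : Y (k + 1) →ₗ[Λ] Y k :=
    - (DirectSum.component Λ ℕ Y k ∘ₗ r ∘ₗ DirectSum.lof Λ ℕ Y (k + 1))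
  have hg : ¬ IsUnit (M := Module.End Λ (Y k)) (g ∘ₗ f k) := fun hu ↦ by
    obtain ⟨g', hg'⟩ := isUnit_comp_of_split hu
    exact hf k g' hg'
  have := hloc k
  have hu := (Module.End.isUnit_iff _).1 (isUnit_one_sub_of_not_isUnit hg)
  refine hu.1 ?_
  rw [map_zero, ← hk]
  simp only [LinearMap.sub_apply, Module.End.one_apply, LinearMap.comp_apply, g, hy,
    LinearMap.neg_apply, sub_neg_eq_add]
  rfl

end Telescope

lemma isTNilpotent_of_exists_isCompl [IsNoetherianRing Λ]
    (h : ∀ X : ModuleCat.{u} Λ, Add M X → ∀ N : Submodule Λ X,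
        IsPureSubmodule N → ∃ N' : Submodule Λ X, IsCompl N N') : IsTNilpotent M := by
  intro Y f y hY hloc hf hy
  let e := DirectSum.lequivCongrLeft Λ (M := fun k ↦ (Y k).obj) Equiv.ulift.{u}.symm
  have hadd : Add M (ModuleCat.of Λ (DirectSum ℕ fun k ↦ (Y k).obj)) :=
    ⟨ULift ℕ, fun k ↦ Y k.down, fun k ↦ hY _, ⟨⟨ModuleCat.ofHom e.toLinearMap,
      ModuleCat.ofHom e.symm.toLinearMap, ModuleCat.hom_ext (LinearMap.ext e.symm_apply_apply)⟩⟩⟩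
  obtain ⟨r, hr⟩ := exists_retraction_of_isCompl (telescope_injective f)
    (h _ hadd _ (isPureSubmodule_range_telescope f))
  exact exists_eq_zero_of_telescope_retraction f hloc hf hr hy

end Radical

/-! ### Finiteness of the number of indecomposables. -/

section Finiteness

variable {Λ : Type u} [Ring Λ] {M : ObjectProperty (FGModuleCat.{u} Λ)} {n : ℕ}

/-- A split monomorphism into a module with local endomorphism ring is an isomorphism. -/
lemma nonempty_linearEquiv_of_retraction {X Y : Type*} [AddCommGroup X] [Module Λ X]
    [AddCommGroup Y] [Module Λ Y] [Nontrivial Y] [IsLocalRing (Module.End Λ X)]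
    {h : Y →ₗ[Λ] X} {g : X →ₗ[Λ] Y} (hg : g ∘ₗ h = LinearMap.id) : Nonempty (Y ≃ₗ[Λ] X) := by
  let e : Module.End Λ X := h ∘ₗ g
  have he : e * e = e := by
    change h ∘ₗ (g ∘ₗ h) ∘ₗ g = h ∘ₗ g
    rw [hg, LinearMap.id_comp]
  -- An idempotent of a local ring is 1 or 0, and `e = 0` would make `Y` zero.
  by_cases hu : IsUnit e
  · have : e = 1 := hu.mul_left_cancel (by rw [he, mul_one])
    exact ⟨.ofLinearMap h g this hg⟩
  · have h0 : e = 0 := (isUnit_one_sub_of_not_isUnit hu).mul_left_cancel (by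
      rw [sub_mul, one_mul, he, sub_self, mul_zero])
    obtain ⟨y, hy⟩ := exists_ne (0 : Y)
    refine absurd ?_ hy
    have hgh (z : Y) : g (h z) = z := congr($hg z)
    rw [← hgh y, ← hgh y, show h (g (h y)) = 0 from congr($h0 (h y)), map_zero]

/-- A morphism from a finitely generated module to a module in `Add(M)` factors through an object
of `M` inside the given target. -/
lemma IsNClusterTilting.exists_factorization_of_add [IsNoetherianRing Λ]
    (hM : IsNClusterTilting n M) {P : ModuleCat.{u} Λ} (hP : Add M P) {F : Type u} [AddCommGroup F]
    [Module Λ F] [Module.Finite Λ F] (H : F →ₗ[Λ] P) :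
    ∃ (Z : FGModuleCat.{u} Λ) (c : P →ₗ[Λ] Z.obj) (b : Z.obj →ₗ[Λ] P), M Z ∧
      b ∘ₗ c ∘ₗ H = H := by
  classical
  obtain ⟨ι, U, hU, ⟨r⟩⟩ := hP
  obtain ⟨s, hs⟩ := exists_finset_factorization (fun i ↦ (U i).obj) (r.i.hom ∘ₗ H)
  refine ⟨FGModuleCat.of Λ (∀ i : s, (U i).obj),
    LinearMap.pi fun i ↦ DirectSum.component Λ ι (fun i ↦ (U i).obj) i ∘ₗ r.i.hom,
    r.r.hom ∘ₗ ∑ i : s, DirectSum.lof Λ ι (fun i ↦ (U i).obj) i ∘ₗ LinearMap.proj i,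
    hM.mem_pi (Z := fun i : s ↦ U i) fun i ↦ hU i, LinearMap.ext fun x ↦ ?_⟩
  have h1 : r.r.hom (r.i.hom (H x)) = H x := congr(($(r.retract)).hom (H x))
  rw [← h1, ← LinearMap.comp_apply r.i.hom H, ← hs x]
  simp only [LinearMap.comp_apply, LinearMap.sum_apply]
  exact congrArg _ (Finset.sum_coe_sort s fun i ↦
    DirectSum.lof Λ ι (fun i ↦ (U i).obj) i (r.i.hom (H x) i))

section

variable [IsArtinAlgebra Λ]

/-- There are only finitely many indecomposable objects of `M`. -/
lemma IsTNilpotent.exists_equiv (h : IsTNilpotent M) (hM : IsNClusterTilting n M)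
    (hadd : lim M ≤ Add M) (X : ℕ → FGModuleCat.{u} Λ) (hX : ∀ i, M (X i))
    (hloc : ∀ i, IsLocalRing (Module.End Λ (X i).obj)) :
    ∃ i j, i ≠ j ∧ Nonempty ((X i).obj ≃ₗ[Λ] (X j).obj) := by
  have := isArtinianRing_of_isArtinAlgebra Λ
  by_contra! hne
  -- A state is an indecomposable of `M` with an element that survives in `X i` for infinitely many
  -- `i`.
  let P : (Σ Y : FGModuleCat.{u} Λ, Y.obj × Set ℕ) → Prop := fun s ↦
    M s.1 ∧ IsLocalRing (Module.End Λ s.1.obj) ∧ s.2.1 ≠ 0 ∧ s.2.2.Infinite ∧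
      ∀ i ∈ s.2.2, ∃ g : s.1.obj →ₗ[Λ] (X i).obj, g s.2.1 ≠ 0
  -- replacing a module by an indecomposable summand
  have hsummand (Z : FGModuleCat.{u} Λ) (hZ : M Z) (z : Z.obj) (S : Set ℕ) (hS : S.Infinite)
      (hg : ∀ i ∈ S, ∃ g : Z.obj →ₗ[Λ] (X i).obj, g z ≠ 0) :
      ∃ (s : Subtype P) (p : Z.obj →ₗ[Λ] s.1.1.obj), p z = s.1.2.1 := by
    choose g hg using fun i : S ↦ hg i i.2
    have := hS.to_subtype
    obtain ⟨Y, p, q, hY, hlocY, hi⟩ := hM.exists_local_summand hZ g hg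
    refine ⟨⟨⟨Y, p z, (↑) '' {i : S | g i (q (p z)) ≠ 0}⟩, hY, hlocY, fun h0 ↦ ?_,
      hi.image Subtype.val_injective.injOn, ?_⟩, p, rfl⟩
    · obtain ⟨i, hi⟩ := hi.nonempty
      exact hi (by rw [show p z = 0 from h0, map_zero, map_zero])
    · rintro _ ⟨i, hi, rfl⟩
      exact ⟨g i ∘ₗ q, hi⟩
  have hempty := h.isEmpty (α := Subtype P) (fun s ↦ s.1.1) (fun s ↦ s.2.1) (fun s ↦ s.2.2.1)
    (fun s ↦ s.1.2.1) (fun s ↦ s.2.2.2.1) ?_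
  · obtain ⟨s, -⟩ := hsummand _ hM.mem_self (1 : Λ) Set.univ Set.infinite_univ fun i _ ↦ by
      have := hloc i
      have : Nontrivial (X i).obj := nontrivial_of_isLocalRing_end (Λ := Λ)
      obtain ⟨x, hx⟩ := exists_ne (0 : (X i).obj)
      exact ⟨LinearMap.toSpanSingleton Λ _ x, by simpa using hx⟩
    exact hempty.false s
  · rintro ⟨⟨Y, y, S⟩, hY, hlocY, hy, hS, hex⟩
    have : IsLocalRing (Module.End Λ Y.obj) := hlocY
    have : Nontrivial Y.obj := nontrivial_of_isLocalRing_end (Λ := Λ)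
    have : Module.Finite Λ Y.obj := Y.property
    -- At most one `X i` is isomorphic to `Y`; discarding it ensures that no component of `H` below
    -- has a retraction, hence neither has `H`.
    let T : Set ℕ := {i | Nonempty (Y.obj ≃ₗ[Λ] (X i).obj)}
    have hT : T.Subsingleton := fun i ⟨e⟩ j ⟨e'⟩ ↦ by
      by_contra hij
      exact (hne i j hij).false (e.symm.trans e')
    have hST : (S \ T).Infinite := hS.sdiff hT.finite
    have hex' : ∀ i ∈ S, ∃ g : Y.obj →ₗ[Λ] (X i).obj, g y ≠ 0 := hex
    choose! g hg using hex'
    let H : Y.obj →ₗ[Λ] ∀ i : ULift.{u} ↥(S \ T), (X i.down).obj :=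
      LinearMap.pi fun i : ULift.{u} ↥(S \ T) ↦ g i.down
    have hH (ρ) : ρ ∘ₗ H ≠ LinearMap.id := fun hρ ↦ by
      obtain ⟨i, g', hg'⟩ := exists_retraction_of_pi _ ρ hρ
      have := hloc i.down
      exact i.down.2.2 (nonempty_linearEquiv_of_retraction hg')
    have hlim : lim M (ModuleCat.of Λ (∀ i : ULift.{u} ↥(S \ T), (X i.down).obj)) :=
      hM.lim_pi fun i ↦ lim_of_mem (hX _)
    -- The product is in `Add M`, so `H` passes through some `Z` in `M`. As `b ∘ c` fixes `H`, the
    -- element `c (H y)` still survives in every remaining `X i`, and a retraction of the resulting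
    -- step would be one of `H`.
    obtain ⟨Z, c, b, hZ, hcb⟩ := hM.exists_factorization_of_add (hadd _ hlim) H
    obtain ⟨s, p, hp⟩ := hsummand Z hZ (c (H y)) (S \ T) hST fun i hi ↦
      ⟨LinearMap.proj (ULift.up ⟨i, hi⟩ : ULift.{u} ↥(S \ T)) ∘ₗ b, by
        have h1 : b (c (H y)) = H y := congr($hcb y)
        rw [LinearMap.comp_apply, h1]
        exact hg i hi.1⟩
    exact ⟨s, p ∘ₗ c ∘ₗ H, fun g' hg' ↦ hH (g' ∘ₗ p ∘ₗ c) hg', hp⟩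

lemma IsTNilpotent.isOfFiniteType (h : IsTNilpotent M) (hM : IsNClusterTilting n M)
    (hadd : lim M ≤ Add M) : IsOfFiniteType M := by
  have := isArtinianRing_of_isArtinAlgebra Λ
  have : HasFiniteBiproducts (FGModuleCat.{u} Λ) := Abelian.hasFiniteBiproducts
  let T := {X : FGModuleCat.{u} Λ // M X ∧ IsLocalRing (Module.End Λ X.obj)}
  let iso : Setoid T :=
    { r X Y := Nonempty (X.1.obj ≃ₗ[Λ] Y.1.obj)
      iseqv := ⟨fun X ↦ ⟨.refl _ _⟩, fun ⟨e⟩ ↦ ⟨e.symm⟩, fun ⟨e⟩ ⟨e'⟩ ↦ ⟨e.trans e'⟩⟩ }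
  have hfin : Finite (_root_.Quotient iso) := by
    by_contra hinf
    rw [not_finite_iff_infinite] at hinf
    let σ := Infinite.natEmbedding (_root_.Quotient iso)
    obtain ⟨i, j, hij, he⟩ := h.exists_equiv hM hadd (fun i ↦ (σ i).out.1) (fun i ↦ (σ i).out.2.1)
      (fun i ↦ (σ i).out.2.2)
    exact hij (σ.injective (_root_.Quotient.out_equiv_out.1 he))
  obtain ⟨m, ⟨e⟩⟩ := Finite.exists_equiv_fin (_root_.Quotient iso)
  let Y (i : ULift.{u} (Fin m)) : FGModuleCat.{u} Λ := (e.symm i.down).out.1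
  let G : FGModuleCat.{u} Λ := FGModuleCat.of Λ (∀ i, (Y i).obj)
  have hG : M G := hM.mem_pi fun i ↦ (e.symm i.down).out.2.1
  have hZ (Z : FGModuleCat.{u} Λ) (hZ : M Z) (hloc : IsLocalRing (Module.End Λ Z.obj)) :
      ∃ (a : Z.obj →ₗ[Λ] G.obj) (b : G.obj →ₗ[Λ] Z.obj), b ∘ₗ a = LinearMap.id := by
    classical
    let q : _root_.Quotient iso := _root_.Quotient.mk _ ⟨Z, hZ, hloc⟩
    have hq : q = e.symm (ULift.up.{u} (e q)).down := (e.symm_apply_apply q).symm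
    obtain ⟨e'⟩ : Nonempty (Z.obj ≃ₗ[Λ] (Y ⟨e q⟩).obj) :=
      iso.symm (_root_.Quotient.exact ((_root_.Quotient.out_eq _).trans hq.symm))
    refine ⟨LinearMap.single Λ (fun i ↦ (Y i).obj) (ULift.up (e q)) ∘ₗ e'.toLinearMap,
      e'.symm.toLinearMap ∘ₗ LinearMap.proj (ULift.up (e q)), LinearMap.ext fun x ↦
      (congrArg e'.symm (Pi.single_eq_same (M := fun i ↦ (Y i).obj) _ (e' x))).trans
        (e'.symm_apply_apply x)⟩
  refine ⟨G, fun X ↦ ⟨fun hX ↦ ?_, fun ⟨k, ⟨r⟩⟩ ↦ ?_⟩⟩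
  · obtain ⟨κ, _, Z, p, q, hloc, hpq, hsum⟩ := exists_decomposition X
    choose a b hba using fun t ↦ hZ (Z t) (hM.mem_of_retract hX _ _ (hpq t)) (hloc t)
    let ε := Fintype.equivFin κ
    refine ⟨Fintype.card κ, ⟨⟨biproduct.lift fun j ↦ FGModuleCat.ofHom (a (ε.symm j) ∘ₗ p (ε.symm j)),
      biproduct.desc fun j ↦ FGModuleCat.ofHom (q (ε.symm j) ∘ₗ b (ε.symm j)), ?_⟩⟩⟩
    rw [biproduct.lift_desc]
    let φ : (X ⟶ X) →+ Module.End Λ X.obj :=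
      { toFun g := g.hom.hom, map_zero' := rfl, map_add' _ _ := rfl }
    have hφ : Function.Injective φ := fun f g hfg ↦ by
      ext x
      exact congr($hfg x)
    refine hφ ?_
    rw [map_sum]
    refine Eq.trans ?_ hsum
    rw [← ε.symm.sum_comp]
    refine Finset.sum_congr rfl fun j _ ↦ LinearMap.ext fun x ↦ ?_
    exact congrArg (q _) congr($(hba (ε.symm j)) (p (ε.symm j) x))
  · refine hM.mem_of_sum_eq_id (ι := Fin k) (fun _ ↦ hG)
      (fun j ↦ (r.i ≫ biproduct.π (fun _ : Fin k ↦ G) j).hom.hom)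
      (fun j ↦ (biproduct.ι (fun _ : Fin k ↦ G) j ≫ r.r).hom.hom) (sum_comp_eq_id r)

end

end Finiteness

end ClusterTilting

theorem theorem2p2 {Λ : Type u} [Ring Λ] [IsArtinAlgebra Λ] (n : ℕ) (hn : 2 ≤ n)
    (M : ObjectProperty (FGModuleCat.{u} Λ)) (hM : ClusterTilting.IsNClusterTilting n M) :
    List.TFAE [
      ClusterTilting.IsOfFiniteType M,
      ClusterTilting.IsNClusterTilting n (ClusterTilting.lim M),
      ClusterTilting.IsNRigid n (ClusterTilting.lim M),
      ∀ X Y : ModuleCat.{u} Λ, ClusterTilting.lim M X → ClusterTilting.lim M Y →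
        ClusterTilting.ExtVanishes X Y 1,
      ∀ X : ModuleCat.{u} Λ, ClusterTilting.Add M X → ∀ N : Submodule Λ X,
        ClusterTilting.IsPureSubmodule N → ∃ N' : Submodule Λ X, IsCompl N N',
      ClusterTilting.LimIsPureSemisimple M] := by
  have := ClusterTilting.isArtinianRing_of_isArtinAlgebra Λ
  tfae_have 3 → 4 := fun h X Y hX hY ↦ h 1 one_pos (by omega) X Y hX hY
  tfae_have 4 → 6 := hM.limIsPureSemisimple_of_ext
  tfae_have 6 → 5 := hM.exists_isCompl_of_limIsPureSemisimple
  tfae_have 5 → 1 := fun h ↦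
    (ClusterTilting.isTNilpotent_of_exists_isCompl h).isOfFiniteType hM (hM.lim_le_add_of_exists_isCompl h)
  tfae_have 1 → 3 := fun h ↦ hM.isNRigid_of_lim_le_add (h.isTNilpotent.lim_le_add hM)
  -- Approximations for cluster tilting also need pure submodules to split, which is drawn from
  -- rigidity through (d) and (f).
  tfae_have 3 → 2 := fun h ↦
    hM.lim_isNClusterTilting hn h (tfae_6_to_5 (tfae_4_to_6 (tfae_3_to_4 h)))
  tfae_have 2 → 3 := fun h k hk hkn X Y hX hY ↦ by
    rw [← h.rightPerp_eq] at hY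
    exact hY k hk hkn X hX
  tfae_finish
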